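/- **Setting.** Let $\triangle_{K-1}=\{y\in\mathbb R^K: y\ge 0,\ \sum_i y_i=1\}$. For nonempty $I\subseteq\{1,\dots,K\}$ let $f_I$ be the face of points whose support is contained in $I$; its relative interior $\mathrm{ri}(f_I)$ consists of the points with support exactly $I$, and $\dim f_I=|I|-1$. For each $I$ fix an index $b_I\in I$; the coordinates $y_i$, $i\in I\setminus\{b_I\}$, are the free coordinates on $\mathrm{ri}(f_I)$. Let $\mu_I$ be the $(|I|-1)$-dimensional Lebesgue measure in the free coordinates on $\mathrm{ri}(f_I)$ (it does not depend on $b_I$; it is the counting measure if $|I|=1$), and let $\mu^\oplus(A)=\sum_{I\ne\varnothing}\mu_I(A\cap \mathrm{ri}(f_I))$ be the direct sum measure. Let $Y$ be a mixed random variable, i.e. a random variable in $\triangle_{K-1}$ with a density $p$ with respect to $\mu^\oplus$. Put $P_F(f_I)=\Pr\{Y\in\mathrm{ri}(f_I)\}$ and $p_{Y\mid F}(y\mid f_I)=p(y)/P_F(f_I)$ for $y\in \mathrm{ri}(f_I)$. The direct sum entropy, in bits, is $$H^\oplus(Y)=-\sum_{I\neq\varnothing}P_F(f_I)\log_2P_F(f_I)-\sum_{I\ne\varnothing}P_F(f_I)\int_{\mathrm{ri}(f_I)}p_{Y\mid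 F}(y\mid f_I)\log_2p_{Y\mid F}(y\mid f_I)\,d\mu_I(y)\in[-\infty,\infty)$$ (terms with $P_F(f_I)=0$ are $0$), and for $N\in\mathbb N$ let $$H_N^\oplus(Y)=H^\oplus(Y)+N\,d,\qquad d=\sum_{k=1}^K(k-1)\sum_{\dim f=k-1}P_F(f)=\mathbb E[\dim F].$$ An *$N$-bit face code for blocks of $n\ge1$ points* is a measurable map $c:(\triangle_{K-1})^n\to\{0,1\}^*$ whose set of codewords is uniquely decodable and such that $c(y)=c(y')$ implies, for all $t\le n$, that $y_t$ and $y'_t$ have the same support and that each of their free coordinates differs by at most $2^{-N}$; that is, the codeword determines the face of each point exactly, and its position within that face to $N$ bits per free coordinate. Let $Y_1,\dots,Y_n$ be i.i.d. copies of $Y$, and write $|w|$ for the length of a word $w$. **Proposition.** Encoding the face of $Y$ losslessly, and its position within that face to $N$-bit precision, takes $H_N^\oplus(Y)$ bits per point, in the following sense. 1. For all $N\ge 0$, $n\ge1$, every $N$-bit face code $c$ for blocks of $n$ points satisfies $\mathbb E\,|c(Y_1,\dots,Y_n)|\ \ge\ n\,H_N^\oplus(Y)$. 2. For every real $B>H^\oplus(Y)$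 there is $N_0$ such that for all $N\ge N_0$ and all $n\ge1$ there is a prefix-free $N$-bit face code $c$ for blocks of $n$ points with $\mathbb E\,|c(Y_1,\dots,Y_n)|\ \le\ n\,(B+N d)+1$. Thus, if $H^\oplus(Y)$ is finite, the minimal expected number of bits per point lies between $H^\oplus_N(Y)$ and $H^\oplus_N(Y)+\frac1n+o(1)$ as $N\to\infty$, uniformly in $n$. -/

import Mathlib

open MeasureTheory
open scoped ENNReal

namespace MixedRV

noncomputable section

/-- The probability simplex of probability vectors on `K` symbols, as a (measurable) subspace of
`Fin K → ℝ`. -/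
abbrev Simplex (K : ℕ) : Type := stdSimplex ℝ (Fin K)

/-- The nonempty faces of the simplex, each given by its nonempty index set `I`: the face of `I`
consists of the points whose support is contained in `I`. -/
abbrev Face (K : ℕ) : Type := {I : Finset (Fin K) // I.Nonempty}

/-- The support of a point of the simplex. -/
def supp {K : ℕ} (y : Simplex K) : Finset (Fin K) :=
  Finset.univ.filter fun k => 0 < y.1 k

/-- The relative interior of the face of `I`. These sets partition the simplex. -/
def relInt {K : ℕ} (I : Face K) : Set (Simplex K) := {y | supp y = I.1}

/-- A choice, for every face, of the coordinate that is eliminated by the constraint `∑ y i = 1`;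
the remaining `|I| - 1` coordinates are the free coordinates of the face. -/
abbrev Elim (K : ℕ) : Type := (I : Face K) → I.1

/-- The indices of the free coordinates of the face `I`. -/
abbrev Free {K : ℕ} (b : Elim K) (I : Face K) : Type :=
  {i : Fin K // i ∈ I.1 ∧ i ≠ (b I : Fin K)}

/-- The range of the free coordinates over the relative interior of the face `I`: an open subset
of `ℝ ^ (|I| - 1)`. -/
def freeRange {K : ℕ} (b : Elim K) (I : Face K) : Set (Free b I → ℝ) :=
  {x | (∀ i, 0 < x i) ∧ ∑ i, x i < 1}

/-- The vector with given free coordinates, whose eliminated coordinate is such that the sum is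
`1`, and which vanishes outside `I`. -/
def chartVec {K : ℕ} (b : Elim K) (I : Face K) (x : Free b I → ℝ) : Fin K → ℝ := fun i =>
  if h : i ∈ I.1 ∧ i ≠ (b I : Fin K) then x ⟨i, h⟩
  else if i = (b I : Fin K) then 1 - ∑ j, x j else 0

theorem chartVec_mem {K : ℕ} (b : Elim K) (I : Face K) (x : Free b I → ℝ)
    (hx : x ∈ freeRange b I) : chartVec b I x ∈ stdSimplex ℝ (Fin K) := by
  refine ⟨fun i => ?_, ?_⟩
  · unfold chartVec
    split_ifs with h h'
    · exact (hx.1 _).le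
    · linarith [hx.2]
    · exact le_rfl
  · have h1 : ∀ i : Fin K, chartVec b I x i =
        (if h : i ∈ I.1 ∧ i ≠ (b I : Fin K) then x ⟨i, h⟩ else 0) +
          (if i = (b I : Fin K) then 1 - ∑ j, x j else 0) := by
      intro i
      unfold chartVec
      split_ifs with h h'
      · exact absurd h' h.2
      all_goals simp
    have h2 : (∑ i : Fin K, if h : i ∈ I.1 ∧ i ≠ (b I : Fin K) then x ⟨i, h⟩ else 0)
        = ∑ j, x j := by
      rw [Finset.sum_dite]
      simp only [Finset.sum_const_zero, add_zero]
      refine Finset.sum_bij (fun i _ => ⟨i.1, (Finset.mem_filter.1 i.2).2⟩) ?_ ?_ ?_ ?_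
      · intro i _; exact Finset.mem_univ _
      · intro i _ j _ hij
        exact Subtype.ext (by simpa using hij)
      · intro j _
        exact ⟨⟨j.1, Finset.mem_filter.2 ⟨Finset.mem_univ _, j.2⟩⟩, Finset.mem_attach _ _, rfl⟩
      · intro i _; rfl
    rw [Finset.sum_congr rfl fun i _ => h1 i, Finset.sum_add_distrib, h2]
    simp

/-- The bijective parametrization of the relative interior of a face by its free coordinates. -/
def chart {K : ℕ} (b : Elim K) (I : Face K) (x : freeRange b I) : Simplex K :=
  ⟨chartVec b I x.1, chartVec_mem b I x.1 x.2⟩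

/-- The measure `A ↦ μ_f (A ∩ ri f)` for the face `f` of `I`, where `μ_f` is the
`(|I| - 1)`-dimensional Lebesgue measure in the free coordinates. It does not depend on the choice
of `b`, and for a vertex (no free coordinate) it is the counting measure. -/
def faceMeasure {K : ℕ} (b : Elim K) (I : Face K) : Measure (Simplex K) :=
  Measure.map (chart b I) (Measure.comap Subtype.val (volume : Measure (Free b I → ℝ)))

/-- The direct sum measure on the simplex. -/
def directSumMeasure {K : ℕ} (b : Elim K) : Measure (Simplex K) :=
  ∑ I : Face K, faceMeasure b I

/-- `Y` is a mixed random variable with density `p` with respect to the direct sum measure. -/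
structure IsMixed {K : ℕ} (b : Elim K) {Ω : Type*} [MeasurableSpace Ω] (P : Measure Ω)
    (Y : Ω → Simplex K) (p : Simplex K → ℝ) : Prop where
  measurable_Y : Measurable Y
  measurable_p : Measurable p
  nonneg : ∀ y, 0 ≤ p y
  law : Measure.map Y P = (directSumMeasure b).withDensity fun y => ENNReal.ofReal (p y)

/-- The probability `P_F(f)` of the face of `I`, where `μ` is the law of `Y` and `F` is the face
in whose relative interior `Y` lies. -/
def faceProb {K : ℕ} (μ : Measure (Simplex K)) (I : Face K) : ℝ := μ.real (relInt I)

/-- The conditional density `p(y | f) = p(y) / P_F(f)`, for `y` in the relative interior of `f`. -/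
def condDensity {K : ℕ} (μ : Measure (Simplex K)) (p : Simplex K → ℝ) (I : Face K)
    (y : Simplex K) : ℝ := p y / faceProb μ I

/-- The entropy `- ∫ q log₂ q dν`, in bits, of a density `q` with respect to `ν`, as the
difference of the integrals of the positive and the negative part of `- q log₂ q`. (If `ν` is a
finite measure, the first one is finite; the value may be `-∞`.) -/
def entropy {α : Type*} [MeasurableSpace α] (ν : Measure α) (q : α → ℝ) : EReal :=
  ((∫⁻ y, ENNReal.ofReal (-(q y * Real.logb 2 (q y))) ∂ν : ℝ≥0∞) : EReal) -
    ((∫⁻ y, ENNReal.ofReal (q y * Real.logb 2 (q y)) ∂ν : ℝ≥0∞) : EReal)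

/-- The direct sum entropy `H(F) + H(Y | F)`, in bits. -/
def directSumEntropy {K : ℕ} (b : Elim K) (μ : Measure (Simplex K)) (p : Simplex K → ℝ) : EReal :=
  ((-∑ I : Face K, faceProb μ I * Real.logb 2 (faceProb μ I) : ℝ) : EReal) +
    ∑ I : Face K, (faceProb μ I : EReal) * entropy (faceMeasure b I) (condDensity μ p I)

/-- The expected dimension of the face of `Y`. -/
def meanFaceDim {K : ℕ} (μ : Measure (Simplex K)) : ℝ :=
  ∑ k ∈ Finset.Icc 1 K, ((k : ℝ) - 1) * ∑ I : Face K with I.1.card = k, faceProb μ I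

/-- The direct sum entropy at `N` bits of precision. -/
def codeLength {K : ℕ} (b : Elim K) (μ : Measure (Simplex K)) (p : Simplex K → ℝ) (N : ℕ) :
    EReal :=
  directSumEntropy b μ p + ((N * meanFaceDim μ : ℝ) : EReal)

/-- `c` is a binary code for blocks of `n` points of the simplex that is uniquely decodable,
encodes the face of every point of the block losslessly, and encodes the position of the point
within that face to `N` bits: the codeword determines each free coordinate up to an interval of
length `2 ^ (-N)`. -/
structure IsFaceCode {K : ℕ} (b : Elim K) (N n : ℕ) (c : (Fin n → Simplex K) → List Bool) :
    Prop where
  measurable : ∀ w, MeasurableSet (c ⁻¹' {w})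
  uniquelyDecodable : InformationTheory.UniquelyDecodable (Set.range c)
  face : ∀ y y', c y = c y' → ∀ t, supp (y t) = supp (y' t)
  precision : ∀ y y', c y = c y' → ∀ t, ∀ I : Face K, y t ∈ relInt I →
    ∀ i : Free b I, |(y t).1 i - (y' t).1 i| ≤ (2 : ℝ)⁻¹ ^ N

/-- No codeword is a proper prefix of another one. -/
def PrefixFree (S : Set (List Bool)) : Prop := ∀ w ∈ S, ∀ w' ∈ S, w <+: w' → w = w'

/-- The expected length of the codeword of a block of `n` independent points with law `μ`. -/
def expectedLength {K : ℕ} (μ : Measure (Simplex K)) {n : ℕ}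
    (c : (Fin n → Simplex K) → List Bool) : ℝ≥0∞ :=
  ∫⁻ y, ((c y).length : ℝ≥0∞) ∂(Measure.pi fun _ : Fin n => μ)

end

end MixedRV

/-! By the chain rule, `H⊕` is the differential entropy of `p` with respect to the direct sum
measure: each term `-P log P` merges with `P · H(p/P)` on its face.

Converse: blocks sharing a codeword have the same faces, and each of their free coordinates varies
by at most `2^(-N)`. They therefore fill a set of product measure at most `2^(-N Σ dim)`. Together
with Kraft–McMillan, this makes `2^(N Σ dim - |c|)` the density of a measure of mass at most one
(`lintegral_kraft_le_one`). Gibbs' inequality against the block density of `p` then bounds the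
expected length below.

Achievability: record the face and the dyadic cube of the free coordinates, and Shannon-code this
finite symbol. What remains is that the entropy of the quantized point minus `N d` is eventually
below every `B > H⊕`. With `φ t = 1 + t log₂ t ≥ 0`, the integral of `φ` over the unit cube,
evaluated at the dyadic averages of the density on a face, equals 1 minus that face's share of this
difference (`sum_dyadicAverage_eq`). The averages converge a.e. by Lebesgue differentiation, so
Fatou's lemma gives the inequality in the direction needed, even when `H⊕ = -∞`. Codes are designed
for a slightly smoothed product distribution, so `N₀` does not depend on `n` and the rounding cost
of one bit is paid once per block. -/

namespace MixedRV

/-! ### Kraft's inequality, its converse, and unique decodability -/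

section Codes

/-- Greedy construction of a prefix-free code with prescribed lengths (converse of Kraft's
inequality). -/
theorem exists_code_of_kraft {A : Type*} [Fintype A] (l : A → ℕ)
    (h : ∑ a, (2⁻¹ : ℝ) ^ l a ≤ 1) :
    ∃ f : A → List Bool, (∀ a, (f a).length = l a) ∧ ∀ a a', f a <+: f a' → a = a' := by
  classical
  suffices H : ∀ s : Finset A, ∑ a ∈ s, (2⁻¹ : ℝ) ^ l a ≤ 1 →
      ∃ f : A → List Bool, (∀ a ∈ s, (f a).length = l a) ∧
        ∀ a ∈ s, ∀ a' ∈ s, f a <+: f a' → a = a' by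
    obtain ⟨f, h1, h2⟩ := H Finset.univ h
    exact ⟨f, fun a => h1 a (Finset.mem_univ _),
      fun a a' => h2 a (Finset.mem_univ _) a' (Finset.mem_univ _)⟩
  intro s
  -- Symbols are added in order of increasing length, so every earlier codeword is at most as long
  -- as the new one and blocks exactly `2^(L - l x)` words of length `L`.
  induction s using Finset.induction_on_max_value l with
  | empty => intro _; exact ⟨fun _ => [], by simp⟩
  | insert a s ha hmax ih =>
    intro hs
    rw [Finset.sum_insert ha] at hs
    have hpos : (0 : ℝ) < 2⁻¹ ^ l a := by positivity
    obtain ⟨f, hf1, hf2⟩ := ih (by linarith)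
    set L := l a with hL
    let all : Finset (List Bool) :=
      (Finset.univ : Finset (List.Vector Bool L)).image fun v => v.1
    let bad : Finset (List Bool) := s.biUnion fun x =>
      (Finset.univ : Finset (List.Vector Bool (L - l x))).image fun v => f x ++ v.1
    have hall : all.card = 2 ^ L := by
      refine (Finset.card_image_of_injective (Finset.univ : Finset (List.Vector Bool L))
        Subtype.val_injective).trans ?_
      simp
    have hbad : bad.card < all.card := by
      have h1 : bad.card ≤ ∑ x ∈ s, 2 ^ (L - l x) := by
        refine Finset.card_biUnion_le.trans (Finset.sum_le_sum fun x _ => ?_)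
        refine Finset.card_image_le.trans ?_
        rw [Finset.card_univ, card_vector]
        simp
      have h2 : (∑ x ∈ s, (2 : ℝ) ^ (L - l x)) < 2 ^ L := by
        have h3 : ∀ x ∈ s, (2 : ℝ) ^ (L - l x) = 2 ^ L * 2⁻¹ ^ l x := by
          intro x hx
          rw [pow_sub₀ _ two_ne_zero (hmax x hx), inv_pow]
        rw [Finset.sum_congr rfl h3, ← Finset.mul_sum]
        -- Strict because the new symbol's own term is positive; this leaves at least one unblocked
        -- word.
        have : ∑ x ∈ s, (2⁻¹ : ℝ) ^ l x < 1 := by linarith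
        have h4 : (0 : ℝ) < 2 ^ L := by positivity
        nlinarith
      rw [hall]
      refine lt_of_le_of_lt h1 ?_
      exact_mod_cast h2
    obtain ⟨w, hw, hwbad⟩ := Finset.exists_mem_notMem_of_card_lt_card hbad
    have hwl : w.length = L := by
      obtain ⟨v, -, rfl⟩ := Finset.mem_image.1 hw
      exact v.2
    have hnp : ∀ x ∈ s, ¬ f x <+: w := by
      rintro x hx ⟨t, ht⟩
      apply hwbad
      refine Finset.mem_biUnion.2 ⟨x, hx, Finset.mem_image.2 ⟨⟨t, ?_⟩, Finset.mem_univ _, ht⟩⟩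
      have := congrArg List.length ht
      rw [List.length_append, hf1 x hx, hwl] at this
      omega
    have hne : ∀ x ∈ s, x ≠ a := fun x hx h => ha (h ▸ hx)
    refine ⟨Function.update f a w, ?_, ?_⟩
    · intro x hx
      rcases Finset.mem_insert.1 hx with rfl | hx
      · simpa using hwl
      · rw [Function.update_of_ne (hne x hx)]; exact hf1 x hx
    · intro x hx y hy hxy
      rcases Finset.mem_insert.1 hx with hxa | hx' <;> rcases Finset.mem_insert.1 hy with hya | hy'
      · rw [hxa, hya]
      · subst hxa
        rw [Function.update_self, Function.update_of_ne (hne y hy')] at hxy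
        have hle := hxy.length_le
        rw [hwl, hf1 y hy'] at hle
        have := hxy.eq_of_length (by rw [hwl, hf1 y hy']; exact le_antisymm hle (hmax y hy'))
        exact absurd (this ▸ List.prefix_rfl) (hnp y hy')
      · subst hya
        rw [Function.update_self, Function.update_of_ne (hne x hx')] at hxy
        exact absurd hxy (hnp x hx')
      · rw [Function.update_of_ne (hne x hx'), Function.update_of_ne (hne y hy')] at hxy
        exact hf2 x hx' y hy' hxy

/-- The first words of two factorizations are prefixes of the same string, hence comparable, hence
equal. The empty word must be excluded: `{[]}` is prefix-free but not uniquely decodable. -/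
theorem PrefixFree.uniquelyDecodable {S : Set (List Bool)} (hS : PrefixFree S) (h0 : [] ∉ S) :
    InformationTheory.UniquelyDecodable S := by
  intro L₁
  induction L₁ with
  | nil =>
    intro L₂ _ h2 h
    cases L₂ with
    | nil => rfl
    | cons w L =>
      simp only [List.flatten_nil, List.flatten_cons] at h
      have : w = [] := (List.append_eq_nil_iff.1 h.symm).1
      exact absurd (h2 w (by simp)) (this ▸ h0)
  | cons w L₁ ih =>
    intro L₂ h1 h2 h
    cases L₂ with
    | nil =>
      simp only [List.flatten_nil, List.flatten_cons] at h
      have : w = [] := (List.append_eq_nil_iff.1 h).1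
      exact absurd (h1 w (by simp)) (this ▸ h0)
    | cons v L₂ =>
      simp only [List.flatten_cons] at h
      have hw : w ∈ S := h1 w (by simp)
      have hv : v ∈ S := h2 v (by simp)
      have hwv : w = v := by
        rcases List.prefix_or_prefix_of_prefix (List.prefix_append w L₁.flatten)
          (h ▸ List.prefix_append v L₂.flatten) with h' | h'
        · exact hS w hw v hv h'
        · exact (hS v hv w hw h').symm
      subst hwv
      rw [ih L₂ (fun x hx => h1 x (by simp [hx])) (fun x hx => h2 x (by simp [hx]))
        (List.append_cancel_left h)]

/-- Kraft–McMillan on every finite subset, since a face code may use infinitely many words. -/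
theorem tsum_kraft_le_one {S : Set (List Bool)} (hS : InformationTheory.UniquelyDecodable S) :
    ∑' w : S, (2⁻¹ : ℝ≥0∞) ^ w.1.length ≤ 1 := by
  classical
  rw [ENNReal.tsum_eq_iSup_sum]
  refine iSup_le fun s => ?_
  have h := InformationTheory.kraft_mcmillan_inequality (S := s.map (Function.Embedding.subtype _))
    (fun L₁ L₂ h1 h2 => hS L₁ L₂ (fun w hw => by
      have := h1 w hw
      simp only [Finset.coe_map, Set.mem_image] at this
      obtain ⟨x, -, rfl⟩ := this
      exact x.2) (fun w hw => by
      have := h2 w hw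
      simp only [Finset.coe_map, Set.mem_image] at this
      obtain ⟨x, -, rfl⟩ := this
      exact x.2))
  rw [Finset.sum_map] at h
  have h2 : ∑ w ∈ s, (2⁻¹ : ℝ≥0∞) ^ w.1.length
      = ENNReal.ofReal (∑ w ∈ s, (2⁻¹ : ℝ) ^ w.1.length) := by
    rw [ENNReal.ofReal_sum_of_nonneg fun _ _ => by positivity]
    refine Finset.sum_congr rfl fun w _ => ?_
    rw [ENNReal.ofReal_pow (by positivity), ENNReal.ofReal_inv_of_pos two_pos]
    simp
  rw [h2]
  refine ENNReal.ofReal_le_one.2 ?_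
  simpa using h

end Codes

/-! ### Extended-real entropy of a density and its chain rule -/

section Entropy

theorem neg_one_le_mul_logb {x : ℝ} (hx : 0 ≤ x) : -1 ≤ x * Real.logb 2 x := by
  rcases hx.eq_or_lt with rfl | hx
  · simp
  have h2 : 0 < Real.log 2 := Real.log_pos one_lt_two
  have h3 : (0.6931471803 : ℝ) < Real.log 2 := Real.log_two_gt_d9
  -- Taken at `2 * x`, the bound `1 - 1/t ≤ log t` gives `x log x ≥ (1 - log 2) x - 1/2`, which
  -- exceeds `-log 2`.
  have h1 := Real.one_sub_inv_le_log_of_pos (show 0 < 2 * x by positivity)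
  rw [Real.log_mul two_ne_zero hx.ne'] at h1
  have h4 : x * (1 - (2 * x)⁻¹) = x - 1 / 2 := by field_simp
  have h5 := mul_le_mul_of_nonneg_left h1 hx.le
  rw [h4] at h5
  have h6 : -Real.log 2 ≤ x * Real.log x := by
    nlinarith [Real.log_two_lt_d9]
  rw [Real.logb, ← mul_div_assoc, le_div_iff₀ h2]
  linarith

theorem measurable_mul_logb {α : Type*} [MeasurableSpace α] {q : α → ℝ} (hq : Measurable q) :
    Measurable fun y => q y * Real.logb 2 (q y) :=
  hq.mul (hq.log.div_const _)

variable {α : Type*} [MeasurableSpace α] {ν : Measure α} {q : α → ℝ}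

theorem lintegral_neg_mul_logb_le (h0 : ∀ y, 0 ≤ q y) :
    ∫⁻ y, ENNReal.ofReal (-(q y * Real.logb 2 (q y))) ∂ν ≤ ν Set.univ := by
  calc _ ≤ ∫⁻ _, 1 ∂ν := lintegral_mono fun y =>
        ENNReal.ofReal_le_one.2 (by linarith [neg_one_le_mul_logb (h0 y)])
    _ = _ := by simp

/-- Since `t = q log₂ q ≥ -1`, the positive parts satisfy `(1 + t)⁺ + (-t)⁺ = 1 + t⁺`. In this form
only one nonnegative integral can be infinite, which suits both summation over faces and Fatou's
lemma. -/
theorem entropy_eq_sub [IsFiniteMeasure ν] (hq : Measurable q) (h0 : ∀ y, 0 ≤ q y) :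
    entropy ν q = ((ν.real Set.univ : ℝ) : EReal) -
      ((∫⁻ y, ENNReal.ofReal (1 + q y * Real.logb 2 (q y)) ∂ν : ℝ≥0∞) : EReal) := by
  unfold entropy
  have hm := measurable_mul_logb hq
  set a := ∫⁻ y, ENNReal.ofReal (-(q y * Real.logb 2 (q y))) ∂ν with ha
  set b := ∫⁻ y, ENNReal.ofReal (q y * Real.logb 2 (q y)) ∂ν with hb
  set c := ∫⁻ y, ENNReal.ofReal (1 + q y * Real.logb 2 (q y)) ∂ν with hc
  have hab : c + a = ν Set.univ + b := by
    rw [hc, ha, hb, ← lintegral_add_left (by fun_prop), ← lintegral_one,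
      ← lintegral_add_left (by fun_prop)]
    refine lintegral_congr fun y => ?_
    have h1 := neg_one_le_mul_logb (h0 y)
    generalize q y * Real.logb 2 (q y) = t at h1
    rcases le_total 0 t with ht | ht
    · rw [ENNReal.ofReal_add zero_le_one ht, ENNReal.ofReal_of_nonpos (show -t ≤ 0 by linarith)]
      simp
    · rw [← ENNReal.ofReal_add (by linarith) (by linarith), ENNReal.ofReal_of_nonpos ht]
      simp
  have hat : a ≠ ∞ := ((lintegral_neg_mul_logb_le h0).trans_lt (measure_lt_top _ _)).ne
  have hν : ν Set.univ ≠ ∞ := measure_ne_top _ _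
  by_cases hbt : b = ∞
  · have hct : c = ∞ := by
      by_contra hct
      rw [hbt, add_top] at hab
      exact ENNReal.add_ne_top.2 ⟨hct, hat⟩ hab
    rw [hbt, hct]; simp
  · have hct : c ≠ ∞ := by
      intro hct
      rw [hct, top_add] at hab
      exact ENNReal.add_ne_top.2 ⟨hν, hbt⟩ hab.symm
    have := congrArg ENNReal.toReal hab
    rw [ENNReal.toReal_add hct hat, ENNReal.toReal_add hν hbt] at this
    rw [← EReal.coe_ennreal_toReal hat, ← EReal.coe_ennreal_toReal hbt,
      ← EReal.coe_ennreal_toReal hct, ← EReal.coe_sub, ← EReal.coe_sub, measureReal_def]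
    congr 1
    linarith

theorem entropy_of_integrable (hi : Integrable (fun y => q y * Real.logb 2 (q y)) ν) :
    entropy ν q = ((-∫ y, q y * Real.logb 2 (q y) ∂ν : ℝ) : EReal) := by
  have h1 : ∫⁻ y, ENNReal.ofReal (q y * Real.logb 2 (q y)) ∂ν ≠ ∞ := hi.lintegral_lt_top.ne
  have h2 : ∫⁻ y, ENNReal.ofReal (-(q y * Real.logb 2 (q y))) ∂ν ≠ ∞ :=
    hi.neg.lintegral_lt_top.ne
  unfold entropy
  rw [integral_eq_lintegral_pos_part_sub_lintegral_neg_part hi, ← EReal.coe_ennreal_toReal h1,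
    ← EReal.coe_ennreal_toReal h2, ← EReal.coe_sub]
  congr 1
  ring

/-- On a finite measure space the integral of `(-q log₂ q)⁺` is finite, so integrability can only
fail through the other part. -/
theorem entropy_of_not_integrable [IsFiniteMeasure ν] (hq : Measurable q) (h0 : ∀ y, 0 ≤ q y)
    (hi : ¬ Integrable (fun y => q y * Real.logb 2 (q y)) ν) : entropy ν q = ⊥ := by
  have hm := measurable_mul_logb hq
  have h2 : ∫⁻ y, ENNReal.ofReal (-(q y * Real.logb 2 (q y))) ∂ν ≠ ∞ :=
    ((lintegral_neg_mul_logb_le h0).trans_lt (measure_lt_top _ _)).ne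
  have h1 : ∫⁻ y, ENNReal.ofReal (q y * Real.logb 2 (q y)) ∂ν = ∞ := by
    by_contra h1
    apply hi
    refine ⟨hm.aestronglyMeasurable, ?_⟩
    rw [hasFiniteIntegral_iff_norm]
    calc ∫⁻ y, ENNReal.ofReal ‖q y * Real.logb 2 (q y)‖ ∂ν
        ≤ ∫⁻ y, (ENNReal.ofReal (q y * Real.logb 2 (q y)) +
            ENNReal.ofReal (-(q y * Real.logb 2 (q y)))) ∂ν := by
          refine lintegral_mono fun y => ?_
          rw [Real.norm_eq_abs]
          rcases abs_cases (q y * Real.logb 2 (q y)) with ⟨h, -⟩ | ⟨h, -⟩ <;> rw [h] <;> simp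
      _ < ∞ := by
          rw [lintegral_add_left (by fun_prop)]
          exact ENNReal.add_lt_top.2 ⟨lt_top_iff_ne_top.2 h1, lt_top_iff_ne_top.2 h2⟩
  unfold entropy
  rw [h1]
  simp

theorem sum_coe_sub_coe_ennreal {ι : Type*} (s : Finset ι) (a : ι → ℝ) (J : ι → ℝ≥0∞) :
    ∑ i ∈ s, ((a i : EReal) - (J i : EReal)) =
      ((∑ i ∈ s, a i : ℝ) : EReal) - ((∑ i ∈ s, J i : ℝ≥0∞) : EReal) := by
  classical
  induction s using Finset.induction_on with
  | empty => simp
  | insert i s hi ih =>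
    rw [Finset.sum_insert hi, Finset.sum_insert hi, Finset.sum_insert hi, ih]
    by_cases h1 : J i = ∞
    · simp [h1]
    by_cases h2 : ∑ i ∈ s, J i = ∞
    · simp [h2]
    rw [← EReal.coe_ennreal_toReal h1, ← EReal.coe_ennreal_toReal h2,
      ← EReal.coe_ennreal_toReal (ENNReal.add_ne_top.2 ⟨h1, h2⟩), ENNReal.toReal_add h1 h2,
      ← EReal.coe_sub, ← EReal.coe_sub, ← EReal.coe_sub, ← EReal.coe_add]
    congr 1
    ring

theorem entropy_sum_measure {ι : Type*} [Fintype ι] (ν : ι → Measure α)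
    [∀ i, IsFiniteMeasure (ν i)] (hq : Measurable q) (h0 : ∀ y, 0 ≤ q y) :
    entropy (∑ i, ν i) q = ∑ i, entropy (ν i) q := by
  rw [Finset.sum_congr rfl fun i _ => entropy_eq_sub (ν := ν i) hq h0, sum_coe_sub_coe_ennreal,
    entropy_eq_sub hq h0]
  congr 2
  · rw [measureReal_def, Measure.finsetSum_apply, ENNReal.toReal_sum fun _ _ => measure_ne_top _ _]
    rfl
  · rw [lintegral_finsetSum_measure]

/-- Rescaling a density to total mass one: the chain rule for a single face. -/
theorem mul_entropy_div_add [IsFiniteMeasure ν] (hq : Measurable q) (h0 : ∀ y, 0 ≤ q y) {Z : ℝ}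
    (hi : Integrable q ν) (hZ : ∫ y, q y ∂ν = Z) :
    (Z : EReal) * entropy ν (fun y => q y / Z) + ((-(Z * Real.logb 2 Z) : ℝ) : EReal) =
      entropy ν q := by
  have hZ0 : 0 ≤ Z := hZ ▸ integral_nonneg h0
  -- For `Z = 0` the quotient is the default `q / 0 = 0`, and `q` vanishes a.e., so both sides are
  -- zero.
  rcases hZ0.eq_or_lt with rfl | hZp
  · have hae : (fun y => q y * Real.logb 2 (q y)) =ᵐ[ν] fun _ => 0 := by
      filter_upwards [(integral_eq_zero_iff_of_nonneg h0 hi).1 hZ] with y hy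
      simp [hy]
    rw [entropy_of_integrable ((integrable_congr hae).2 (integrable_zero _ _ _)),
      integral_congr_ae hae]
    simp
  have hqZ : Measurable fun y => q y / Z := hq.div_const Z
  have hqZ0 : ∀ y, 0 ≤ q y / Z := fun y => div_nonneg (h0 y) hZ0
  have key : ∀ y, q y / Z * Real.logb 2 (q y / Z) =
      Z⁻¹ * (q y * Real.logb 2 (q y)) - Z⁻¹ * Real.logb 2 Z * q y := by
    intro y
    rcases (h0 y).eq_or_lt with h | h
    · simp [← h]
    · rw [Real.logb_div h.ne' hZp.ne']; ring
  by_cases hI : Integrable (fun y => q y * Real.logb 2 (q y)) ν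
  · have hI' : Integrable (fun y => q y / Z * Real.logb 2 (q y / Z)) ν := by
      simp_rw [key]
      exact (hI.const_mul _).sub (hi.const_mul _)
    rw [entropy_of_integrable hI, entropy_of_integrable hI', ← EReal.coe_mul, ← EReal.coe_add]
    congr 1
    simp_rw [key]
    rw [integral_sub (hI.const_mul _) (hi.const_mul _), integral_const_mul, integral_const_mul, hZ]
    field_simp
    ring
  · have hI' : ¬ Integrable (fun y => q y / Z * Real.logb 2 (q y / Z)) ν := by
      intro h
      apply hI
      have : (fun y => q y * Real.logb 2 (q y)) = fun y =>
          Z * (q y / Z * Real.logb 2 (q y / Z)) + Real.logb 2 Z * q y := by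
        funext y
        rw [key]
        field_simp
        ring
      rw [this]
      exact (h.const_mul _).add (hi.const_mul _)
    rw [entropy_of_not_integrable hq h0 hI, entropy_of_not_integrable hqZ hqZ0 hI',
      EReal.coe_mul_bot_of_pos hZp, EReal.bot_add]

end Entropy

/-! ### Product measures with product densities -/

section Product

theorem lintegral_pi_prod {n : ℕ} {α : Type*} [MeasurableSpace α] (ν : Measure α) [SigmaFinite ν]
    {f : Fin n → α → ℝ≥0∞} (hf : ∀ i, Measurable (f i)) :
    ∫⁻ x, ∏ i, f i (x i) ∂(Measure.pi fun _ : Fin n => ν) = ∏ i, ∫⁻ x, f i x ∂ν := by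
  induction n with
  | zero => simp
  | succ n ih =>
    rw [← ((measurePreserving_piFinSuccAbove (fun _ : Fin (n + 1) => ν) 0).symm).lintegral_comp_emb
      (MeasurableEquiv.measurableEmbedding _)]
    simp_rw [MeasurableEquiv.piFinSuccAbove_symm_apply, Fin.insertNthEquiv, Fin.prod_univ_succ,
      Fin.insertNth_zero, Equiv.coe_fn_mk, Fin.cons_succ, Fin.cons_zero]
    rw [← ih fun i => hf i.succ, ← lintegral_prod_mul (hf 0).aemeasurable]
    · rfl
    · exact (Finset.measurable_prod _ fun i _ =>
        (hf i.succ).comp (measurable_pi_apply i)).aemeasurable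

theorem pi_withDensity {n : ℕ} {α : Type*} [MeasurableSpace α] (ν : Measure α) [SigmaFinite ν]
    {f : α → ℝ≥0∞} (hf : Measurable f) [SigmaFinite (ν.withDensity f)] :
    Measure.pi (fun _ : Fin n => ν.withDensity f) =
      (Measure.pi fun _ : Fin n => ν).withDensity fun x => ∏ i, f (x i) := by
  classical
  refine Measure.pi_eq fun s hs => ?_
  rw [withDensity_apply _ (MeasurableSet.univ_pi hs), ← lintegral_indicator (MeasurableSet.univ_pi hs)]
  have : ∀ x : Fin n → α, (Set.univ.pi s).indicator (fun x => ∏ i, f (x i)) x =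
      ∏ i, (s i).indicator f (x i) := by
    intro x
    by_cases hx : x ∈ Set.univ.pi s
    · rw [Set.indicator_of_mem hx]
      exact Finset.prod_congr rfl fun i _ => (Set.indicator_of_mem (hx i trivial) f).symm
    · rw [Set.indicator_of_notMem hx]
      simp only [Set.mem_univ_pi, not_forall] at hx
      obtain ⟨i, hi⟩ := hx
      exact (Finset.prod_eq_zero (Finset.mem_univ i) (Set.indicator_of_notMem hi f)).symm
  simp_rw [this]
  rw [lintegral_pi_prod ν fun i => hf.indicator (hs i)]
  refine Finset.prod_congr rfl fun i _ => ?_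
  rw [withDensity_apply _ (hs i), lintegral_indicator (hs i)]

end Product

/-! ### Faces, charts and the direct sum measure -/

section Geometry

variable {K : ℕ}

theorem mem_supp {y : Simplex K} {k : Fin K} : k ∈ supp y ↔ 0 < y.1 k := by simp [supp]

theorem supp_nonempty (y : Simplex K) : (supp y).Nonempty := by
  by_contra h
  rw [Finset.not_nonempty_iff_eq_empty] at h
  have h1 : ∀ k, y.1 k = 0 := fun k => le_antisymm
    (not_lt.1 fun hk => by simpa [h] using mem_supp.2 hk) (y.2.1 k)
  have h2 := y.2.2
  simp [h1] at h2

theorem measurableSet_relInt (I : Face K) : MeasurableSet (relInt I) := by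
  have : relInt I = ⋂ k, {y : Simplex K | k ∈ I.1 ↔ 0 < y.1 k} := by
    ext y
    simp only [relInt, Set.mem_ofPred_eq, Set.mem_iInter, Finset.ext_iff, mem_supp]
    exact forall_congr' fun k => iff_comm
  rw [this]
  refine MeasurableSet.iInter fun k => ?_
  have hk : MeasurableSet {y : Simplex K | 0 < y.1 k} :=
    measurableSet_lt measurable_const ((measurable_pi_apply k).comp measurable_subtype_coe)
  by_cases h : k ∈ I.1
  · simpa [h] using hk
  · have : {y : Simplex K | k ∈ I.1 ↔ 0 < y.1 k} = {y : Simplex K | 0 < y.1 k}ᶜ := by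
      ext y; simp [h]
    rw [this]
    exact hk.compl

theorem measurableSet_freeRange (b : Elim K) (I : Face K) : MeasurableSet (freeRange b I) := by
  have : freeRange b I = (⋂ i, {x : Free b I → ℝ | 0 < x i}) ∩ {x | ∑ i, x i < 1} := by
    ext x; simp [freeRange]
  rw [this]
  exact (MeasurableSet.iInter fun i => measurableSet_lt measurable_const
    (measurable_pi_apply i)).inter (measurableSet_lt (by fun_prop) measurable_const)

theorem measurable_chart (b : Elim K) (I : Face K) : Measurable (chart b I) := by
  refine Measurable.subtype_mk (measurable_pi_iff.2 fun i => ?_)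
  unfold chartVec
  split_ifs
  · exact (measurable_pi_apply _).comp measurable_subtype_coe
  · fun_prop
  · fun_prop

/-- The free coordinates of the face `I`. -/
def freeCoord (b : Elim K) (I : Face K) (y : Simplex K) : Free b I → ℝ := fun i => y.1 i

theorem measurable_freeCoord (b : Elim K) (I : Face K) : Measurable (freeCoord b I) :=
  measurable_pi_iff.2 fun _ => (measurable_pi_apply _).comp measurable_subtype_coe

theorem freeCoord_chart (b : Elim K) (I : Face K) (x : freeRange b I) :
    freeCoord b I (chart b I x) = x.1 := by
  funext i
  simp [freeCoord, chart, chartVec, i.2.1, i.2.2]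

theorem chart_mem_relInt (b : Elim K) (I : Face K) (x : freeRange b I) :
    chart b I x ∈ relInt I := by
  ext k
  rw [mem_supp]
  change 0 < chartVec b I x.1 k ↔ _
  unfold chartVec
  split_ifs with h h'
  · simpa [h.1] using x.2.1 _
  · simp only [h', (b I).2, iff_true]
    linarith [x.2.2]
  · simp only [lt_self_iff_false, false_iff]
    exact fun hk => h ⟨hk, h'⟩

theorem card_free (b : Elim K) (I : Face K) : Fintype.card (Free b I) = I.1.card - 1 := by
  rw [← Finset.card_erase_of_mem (b I).2]
  refine Fintype.card_of_subtype _ fun i => ?_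
  rw [Finset.mem_erase, and_comm]

/-- A function on the simplex, restricted to the relative interior of `I`, written in the free
coordinates and extended by zero. -/
noncomputable def inChart (b : Elim K) (I : Face K) {β : Type*} [Zero β] (f : Simplex K → β) :
    (Free b I → ℝ) → β := Function.extend Subtype.val (f ∘ chart b I) 0

section

variable {β : Type*} [Zero β] (b : Elim K) (I : Face K) (f : Simplex K → β)

theorem inChart_coe (x : freeRange b I) : inChart b I f x.1 = f (chart b I x) :=
  Subtype.val_injective.extend_apply _ _ _

theorem inChart_of_notMem {x : Free b I → ℝ} (hx : x ∉ freeRange b I) : inChart b I f x = 0 := by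
  unfold inChart
  rw [Function.extend_apply' _ _ _ (by rintro ⟨a, rfl⟩; exact hx a.2)]
  rfl

/-- The same `y` serves every `g`, so `p` and functions built from `p` can be compared at one point
of the simplex. -/
theorem inChart_eq_zero_or (x : Free b I → ℝ) :
    (x ∉ freeRange b I ∧ inChart b I f x = 0) ∨
      ∃ y : Simplex K, y ∈ relInt I ∧ freeCoord b I y = x ∧ inChart b I f x = f y ∧
        ∀ {γ : Type} [Zero γ] (g : Simplex K → γ), inChart b I g x = g y := by
  by_cases hx : x ∈ freeRange b I
  · exact Or.inr ⟨chart b I ⟨x, hx⟩, chart_mem_relInt b I _, freeCoord_chart b I _,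
      inChart_coe b I f ⟨x, hx⟩, fun g => inChart_coe b I g ⟨x, hx⟩⟩
  · exact Or.inl ⟨hx, inChart_of_notMem b I f hx⟩

theorem measurable_inChart [MeasurableSpace β] {f : Simplex K → β} (hf : Measurable f) :
    Measurable (inChart b I f) :=
  (MeasurableEmbedding.subtype_coe (measurableSet_freeRange b I)).measurable_extend
    (hf.comp (measurable_chart b I)) measurable_const

end

theorem lintegral_faceMeasure (b : Elim K) (I : Face K) {f : Simplex K → ℝ≥0∞}
    (hf : Measurable f) : ∫⁻ y, f y ∂(faceMeasure b I) = ∫⁻ x, inChart b I f x := by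
  unfold faceMeasure
  rw [lintegral_map hf (measurable_chart b I)]
  simp_rw [← inChart_coe b I f]
  rw [lintegral_subtype_comap (measurableSet_freeRange b I),
    ← lintegral_indicator (measurableSet_freeRange b I)]
  refine lintegral_congr fun x => ?_
  by_cases hx : x ∈ freeRange b I
  · rw [Set.indicator_of_mem hx]
  · rw [Set.indicator_of_notMem hx, inChart_of_notMem b I f hx]

/-- The half-open unit cube. -/
def unitCube (ι : Type*) : Set (ι → ℝ) := Set.univ.pi fun _ => Set.Ico 0 1

theorem volume_unitCube (ι : Type*) [Fintype ι] : volume (unitCube ι) = 1 := by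
  simp [unitCube, volume_pi_pi]

theorem measurableSet_unitCube (ι : Type*) [Fintype ι] : MeasurableSet (unitCube ι) :=
  MeasurableSet.univ_pi fun _ => measurableSet_Ico

theorem freeRange_subset_unitCube (b : Elim K) (I : Face K) :
    freeRange b I ⊆ unitCube (Free b I) := by
  intro x hx i _
  refine ⟨(hx.1 i).le, lt_of_le_of_lt ?_ hx.2⟩
  exact Finset.single_le_sum (fun j _ => (hx.1 j).le) (Finset.mem_univ i)

/-- Unlike the range of the chart, the cube has volume one and is exactly tiled by dyadic cubes. -/
theorem lintegral_faceMeasure_unitCube (b : Elim K) (I : Face K) {f : Simplex K → ℝ≥0∞}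
    (hf : Measurable f) :
    ∫⁻ y, f y ∂(faceMeasure b I) = ∫⁻ x in unitCube (Free b I), inChart b I f x := by
  rw [lintegral_faceMeasure b I hf, ← lintegral_indicator (measurableSet_unitCube _)]
  refine lintegral_congr fun x => ?_
  by_cases hx : x ∈ unitCube (Free b I)
  · rw [Set.indicator_of_mem hx]
  · rw [Set.indicator_of_notMem hx, inChart_of_notMem b I f
      fun h => hx (freeRange_subset_unitCube b I h)]

instance (b : Elim K) (I : Face K) : IsFiniteMeasure (faceMeasure b I) := by
  refine ⟨?_⟩
  rw [← lintegral_one, lintegral_faceMeasure_unitCube b I measurable_const]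
  calc _ ≤ ∫⁻ x in unitCube (Free b I), 1 := lintegral_mono fun x => by
        rcases inChart_eq_zero_or b I (fun _ => (1 : ℝ≥0∞)) x with ⟨-, h⟩ | ⟨y, -, -, h, -⟩ <;>
          rw [h]
        exact zero_le_one
    _ < ∞ := by simp [volume_unitCube]

instance (b : Elim K) : IsFiniteMeasure (directSumMeasure b) := by
  unfold directSumMeasure
  infer_instance

theorem faceMeasure_compl_relInt (b : Elim K) (I : Face K) :
    faceMeasure b I (relInt I)ᶜ = 0 := by
  rw [faceMeasure, Measure.map_apply (measurable_chart b I) (measurableSet_relInt I).compl]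
  have : chart b I ⁻¹' (relInt I)ᶜ = ∅ := by
    ext x; simpa using chart_mem_relInt b I x
  rw [this, measure_empty]

theorem faceMeasure_relInt_of_ne (b : Elim K) {I J : Face K} (h : I ≠ J) :
    faceMeasure b J (relInt I) = 0 := by
  refine measure_mono_null (fun y hy => ?_) (faceMeasure_compl_relInt b J)
  intro hy'
  exact h (Subtype.ext (hy.symm.trans hy'))

theorem directSumMeasure_restrict (b : Elim K) (I : Face K) :
    (directSumMeasure b).restrict (relInt I) = faceMeasure b I := by
  ext s hs
  rw [Measure.restrict_apply hs, directSumMeasure, Measure.finsetSum_apply,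
    Finset.sum_eq_single I]
  · refine le_antisymm (measure_mono Set.inter_subset_left) ?_
    calc faceMeasure b I s ≤ faceMeasure b I (s ∩ relInt I ∪ (relInt I)ᶜ) :=
          measure_mono fun y hy => by
            by_cases h : y ∈ relInt I
            · exact Or.inl ⟨hy, h⟩
            · exact Or.inr h
      _ ≤ _ := measure_union_le _ _
      _ = _ := by rw [faceMeasure_compl_relInt, add_zero]
  · exact fun J _ hJ => measure_mono_null Set.inter_subset_right
      (faceMeasure_relInt_of_ne b hJ.symm)
  · exact fun h => absurd (Finset.mem_univ I) h

/-- The free coordinates map the measure of a face to a measure below Lebesgue measure. -/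
theorem directSumMeasure_le_volume (b : Elim K) (I : Face K) {s : Set (Simplex K)}
    (hs : s ⊆ relInt I) : directSumMeasure b s ≤ volume (freeCoord b I '' s) := by
  -- Neither `s` nor its image is assumed measurable, so the image is replaced by a measurable hull
  -- of equal volume.
  set t := toMeasurable volume (freeCoord b I '' s) with ht
  have htm : MeasurableSet t := measurableSet_toMeasurable _ _
  have hst : s ⊆ freeCoord b I ⁻¹' t ∩ relInt I := fun y hy =>
    ⟨subset_toMeasurable _ _ ⟨y, hy, rfl⟩, hs hy⟩
  have hm := measurable_freeCoord b I htm
  calc directSumMeasure b s ≤ directSumMeasure b (freeCoord b I ⁻¹' t ∩ relInt I) :=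
        measure_mono hst
    _ = faceMeasure b I (freeCoord b I ⁻¹' t) := by
        rw [← directSumMeasure_restrict b I, Measure.restrict_apply hm]
    _ = ∫⁻ x, inChart b I ((freeCoord b I ⁻¹' t).indicator 1) x := by
        rw [← lintegral_faceMeasure b I (measurable_one.indicator hm), lintegral_indicator_one hm]
    _ ≤ ∫⁻ x, t.indicator 1 x := by
        refine lintegral_mono fun x => ?_
        rcases inChart_eq_zero_or b I ((freeCoord b I ⁻¹' t).indicator (1 : Simplex K → ℝ≥0∞)) x
          with ⟨-, h⟩ | ⟨y, -, rfl, h, -⟩ <;> rw [h]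
        · exact zero_le
        · exact le_of_eq rfl
    _ = volume (freeCoord b I '' s) := by
        rw [lintegral_indicator_one htm, ht, measure_toMeasurable]

end Geometry

/-! ### The direct sum entropy as the entropy of one density -/

section Law

variable {K : ℕ} {b : Elim K} {μ : Measure (Simplex K)} {p : Simplex K → ℝ}

theorem integrable_density [IsProbabilityMeasure μ] (hp : Measurable p) (h0 : ∀ y, 0 ≤ p y)
    (hμ : μ = (directSumMeasure b).withDensity fun y => ENNReal.ofReal (p y)) :
    Integrable p (directSumMeasure b) := by
  refine ⟨hp.aestronglyMeasurable, ?_⟩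
  rw [hasFiniteIntegral_iff_ofReal (Filter.Eventually.of_forall h0)]
  have : μ Set.univ < ∞ := measure_lt_top _ _
  rwa [hμ, withDensity_apply _ MeasurableSet.univ, Measure.restrict_univ] at this

theorem faceProb_eq_integral (hp : Measurable p) (h0 : ∀ y, 0 ≤ p y)
    (hμ : μ = (directSumMeasure b).withDensity fun y => ENNReal.ofReal (p y)) (I : Face K) :
    ∫ y, p y ∂(faceMeasure b I) = faceProb μ I := by
  rw [faceProb, measureReal_def, hμ, withDensity_apply _ (measurableSet_relInt I),
    directSumMeasure_restrict,
    integral_eq_lintegral_of_nonneg_ae (Filter.Eventually.of_forall h0) hp.aestronglyMeasurable]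

/-- The chain rule `H(F) + H(Y | F)`, applied face by face; normalization by the face probabilities
disappears. -/
theorem directSumEntropy_eq_sum [IsProbabilityMeasure μ] (hp : Measurable p) (h0 : ∀ y, 0 ≤ p y)
    (hμ : μ = (directSumMeasure b).withDensity fun y => ENNReal.ofReal (p y)) :
    directSumEntropy b μ p = ∑ I : Face K, entropy (faceMeasure b I) p := by
  have hi := integrable_density hp h0 hμ
  have hI : ∀ I, Integrable p (faceMeasure b I) := fun I => by
    rw [← directSumMeasure_restrict b I]; exact hi.restrict
  have hcoe : ((-∑ I : Face K, faceProb μ I * Real.logb 2 (faceProb μ I) : ℝ) : EReal) =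
      ∑ I : Face K, ((-(faceProb μ I * Real.logb 2 (faceProb μ I)) : ℝ) : EReal) := by
    rw [← Finset.sum_neg_distrib]
    exact map_sum (⟨⟨Real.toEReal, EReal.coe_zero⟩, EReal.coe_add⟩ : ℝ →+ EReal) _ _
  rw [directSumEntropy, hcoe, ← Finset.sum_add_distrib]
  refine Finset.sum_congr rfl fun I _ => ?_
  rw [add_comm]
  exact mul_entropy_div_add hp h0 (hI I) (faceProb_eq_integral hp h0 hμ I)

theorem directSumEntropy_eq [IsProbabilityMeasure μ] (hp : Measurable p) (h0 : ∀ y, 0 ≤ p y)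
    (hμ : μ = (directSumMeasure b).withDensity fun y => ENNReal.ofReal (p y)) :
    directSumEntropy b μ p = entropy (directSumMeasure b) p := by
  rw [directSumEntropy_eq_sum hp h0 hμ, directSumMeasure, entropy_sum_measure _ hp h0]

theorem meanFaceDim_eq_sum (μ : Measure (Simplex K)) :
    meanFaceDim μ = ∑ I : Face K, ((I.1.card : ℝ) - 1) * faceProb μ I := by
  unfold meanFaceDim
  rw [← Finset.sum_fiberwise_of_maps_to (s := (Finset.univ : Finset (Face K)))
    (t := Finset.Icc 1 K) (g := fun I => I.1.card)]
  · refine Finset.sum_congr rfl fun k _ => ?_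
    rw [Finset.mul_sum]
    refine Finset.sum_congr rfl fun I hI => ?_
    rw [(Finset.mem_filter.1 hI).2]
  · intro I _
    exact Finset.mem_Icc.2 ⟨Finset.card_pos.2 I.2, by simpa using Finset.card_le_univ I.1⟩

end Law

variable {K : ℕ} {b : Elim K} {μ : Measure (Simplex K)} {p : Simplex K → ℝ}

/-! ### Expectations of finite-valued functions and of block sums -/

section FiniteValued

variable {X A : Type*} [Fintype A] {g : X → A}

theorem comp_eq_sum_indicator (g : X → A) (h : A → ℝ) (x : X) :
    h (g x) = ∑ a, (g ⁻¹' {a}).indicator (fun _ => h a) x := by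
  rw [Finset.sum_eq_single (g x)]
  · exact (Set.indicator_of_mem (s := g ⁻¹' {g x}) rfl (fun _ => h (g x))).symm
  · exact fun a _ ha => Set.indicator_of_notMem (fun h' => ha (Eq.symm h')) _
  · exact fun h => absurd (Finset.mem_univ _) h

variable [MeasurableSpace X]

theorem measurable_comp_of_finite (hg : ∀ a, MeasurableSet (g ⁻¹' {a})) (h : A → ℝ) :
    Measurable fun x => h (g x) := by
  simp_rw [comp_eq_sum_indicator g h]
  exact Finset.measurable_sum _ fun a _ => measurable_const.indicator (hg a)

theorem integrable_comp_of_finite (μ : Measure X) [IsFiniteMeasure μ]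
    (hg : ∀ a, MeasurableSet (g ⁻¹' {a})) (h : A → ℝ) : Integrable (fun x => h (g x)) μ := by
  simp_rw [comp_eq_sum_indicator g h]
  exact integrable_finsetSum _ fun a _ => (integrable_const _).indicator (hg a)

theorem integral_comp_of_finite (μ : Measure X) [IsFiniteMeasure μ]
    (hg : ∀ a, MeasurableSet (g ⁻¹' {a})) (h : A → ℝ) :
    ∫ x, h (g x) ∂μ = ∑ a, h a * μ.real (g ⁻¹' {a}) := by
  simp_rw [comp_eq_sum_indicator g h]
  rw [integral_finsetSum _ fun a _ => (integrable_const _).indicator (hg a)]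
  refine Finset.sum_congr rfl fun a _ => ?_
  rw [integral_indicator_const _ (hg a), smul_eq_mul, mul_comm]

end FiniteValued

/-- The expectation of a sum over a block of independent points. -/
theorem integral_pi_sum {n : ℕ} {X : Type*} [MeasurableSpace X] {μ : Measure X}
    [IsProbabilityMeasure μ] {f : X → ℝ} (hf : Integrable f μ) :
    Integrable (fun y : Fin n → X => ∑ t, f (y t)) (Measure.pi fun _ => μ) ∧
      ∫ y, ∑ t, f (y t) ∂(Measure.pi fun _ : Fin n => μ) = n * ∫ y, f y ∂μ := by
  have h1 : ∀ t : Fin n, Integrable (fun y : Fin n → X => f (y t))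
      (Measure.pi fun _ => μ) := fun t =>
    (measurePreserving_eval (fun _ : Fin n => μ) t).integrable_comp_of_integrable hf
  refine ⟨integrable_finsetSum _ fun t _ => h1 t, ?_⟩
  rw [integral_finsetSum _ fun t _ => h1 t]
  have h2 : ∀ t : Fin n, ∫ y : Fin n → X, f (y t) ∂(Measure.pi fun _ => μ) =
      ∫ y, f y ∂μ := fun t => by
    have hm := (measurePreserving_eval (fun _ : Fin n => μ) t)
    have := integral_map (μ := Measure.pi fun _ : Fin n => μ) hm.measurable.aemeasurable
      (f := f) (by rw [hm.map_eq]; exact hf.aestronglyMeasurable)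
    rw [hm.map_eq] at this
    exact this.symm
  simp [h2]

/-! ### The face dimension as a random variable -/

section FaceDim

/-- The dimension of the face in whose relative interior a point lies. -/
noncomputable def faceDim (y : Simplex K) : ℕ := (supp y).card - 1

/-- The face in whose relative interior a point lies. -/
noncomputable def faceOf (y : Simplex K) : Face K := ⟨supp y, supp_nonempty y⟩

theorem mem_relInt_faceOf (y : Simplex K) : y ∈ relInt (faceOf y) := rfl

theorem faceOf_eq_iff {y : Simplex K} {I : Face K} : faceOf y = I ↔ y ∈ relInt I := Subtype.ext_iff

theorem preimage_faceOf (I : Face K) : (faceOf ⁻¹' {I} : Set (Simplex K)) = relInt I :=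
  Set.ext fun _ => faceOf_eq_iff

theorem measurableSet_preimage_faceOf (I : Face K) :
    MeasurableSet (faceOf ⁻¹' {I} : Set (Simplex K)) := by
  rw [preimage_faceOf]; exact measurableSet_relInt I

theorem coe_faceDim (y : Simplex K) : (faceDim y : ℝ) = ((faceOf y).1.card : ℝ) - 1 := by
  rw [faceDim, Nat.cast_sub (Finset.card_pos.2 (supp_nonempty y)), Nat.cast_one]
  rfl

theorem integrable_faceDim [IsFiniteMeasure μ] : Integrable (fun y => (faceDim y : ℝ)) μ := by
  simp_rw [coe_faceDim]
  exact integrable_comp_of_finite μ measurableSet_preimage_faceOf fun I => (I.1.card : ℝ) - 1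

theorem integral_faceDim [IsFiniteMeasure μ] : ∫ y, (faceDim y : ℝ) ∂μ = meanFaceDim μ := by
  simp_rw [coe_faceDim]
  rw [meanFaceDim_eq_sum,
    integral_comp_of_finite μ measurableSet_preimage_faceOf fun I => (I.1.card : ℝ) - 1]
  simp_rw [preimage_faceOf, faceProb]

end FaceDim

/-! ### The converse bound for every face code -/

section LowerBound

variable {N n : ℕ} {c : (Fin n → Simplex K) → List Bool}

/-- The volume of the set of blocks that share a codeword. -/
theorem pi_directSumMeasure_cell_le (hc : IsFaceCode b N n c) (y₀ : Fin n → Simplex K) :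
    Measure.pi (fun _ : Fin n => directSumMeasure b) (c ⁻¹' {c y₀}) ≤
      2⁻¹ ^ (N * ∑ t, faceDim (y₀ t)) := by
  set A := c ⁻¹' {c y₀} with hA
  -- A codeword's cell need not be a product set, but it lies in the box of its coordinate
  -- projections, and each projection stays within one face and has width at most `2^(-N)` in every
  -- free coordinate.
  calc Measure.pi (fun _ : Fin n => directSumMeasure b) A
      ≤ Measure.pi (fun _ : Fin n => directSumMeasure b)
          (Set.univ.pi fun t => Function.eval t '' A) :=
        measure_mono fun y hy t _ => ⟨y, hy, rfl⟩
    _ = ∏ t, directSumMeasure b (Function.eval t '' A) := Measure.pi_pi _ _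
    _ ≤ ∏ t, (2⁻¹ : ℝ≥0∞) ^ (N * faceDim (y₀ t)) := Finset.prod_le_prod' fun t _ => ?_
    _ = 2⁻¹ ^ (N * ∑ t, faceDim (y₀ t)) := by rw [Finset.prod_pow_eq_pow_sum, Finset.mul_sum]
  have hsub : Function.eval t '' A ⊆ relInt (faceOf (y₀ t)) := by
    rintro _ ⟨y, hy, rfl⟩
    exact hc.face y y₀ hy t
  refine (directSumMeasure_le_volume b _ hsub).trans ((Real.volume_pi_le_prod_diam _).trans ?_)
  calc _ ≤ ∏ _i : Free b (faceOf (y₀ t)), (2⁻¹ : ℝ≥0∞) ^ N := Finset.prod_le_prod' fun i _ => ?_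
    _ = _ := by
      rw [Finset.prod_const, Finset.card_univ, card_free, ← pow_mul]
      rfl
  refine Metric.ediam_le ?_
  rintro _ ⟨_, ⟨_, ⟨y, hy, rfl⟩, rfl⟩, rfl⟩ _ ⟨_, ⟨_, ⟨y', hy', rfl⟩, rfl⟩, rfl⟩
  have hI : y t ∈ relInt (faceOf (y₀ t)) := hsub ⟨y, hy, rfl⟩
  have h := hc.precision y y' (Eq.trans hy (Eq.symm hy')) t _ hI i
  have h2 : (2⁻¹ : ℝ≥0∞) ^ N = ENNReal.ofReal ((2 : ℝ)⁻¹ ^ N) := by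
    rw [ENNReal.ofReal_pow (by positivity), ENNReal.ofReal_inv_of_pos two_pos]
    simp
  rw [edist_dist, h2]
  exact ENNReal.ofReal_le_ofReal h

/-- The integrand is constant on each codeword's cell. The volume bound cancels the factor `2^(N Σ
dim)`, so the cell contributes at most `2^(-|w|)`, and Kraft–McMillan sums these. -/
theorem lintegral_kraft_le_one (hc : IsFaceCode b N n c) :
    ∫⁻ y, 2 ^ (N * ∑ t, faceDim (y t)) * 2⁻¹ ^ (c y).length
      ∂(Measure.pi fun _ : Fin n => directSumMeasure b) ≤ 1 := by
  have hU : (⋃ w : Set.range c, c ⁻¹' {w.1}) = Set.univ := by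
    ext y; simp
  rw [← setLIntegral_univ, ← hU]
  refine (lintegral_iUnion_le _ _).trans (le_trans ?_ (tsum_kraft_le_one hc.uniquelyDecodable))
  refine ENNReal.tsum_le_tsum fun ⟨w, y₀, hw⟩ => ?_
  subst hw
  have hcell : ∀ y ∈ c ⁻¹' {c y₀}, (2 : ℝ≥0∞) ^ (N * ∑ t, faceDim (y t)) * 2⁻¹ ^ (c y).length =
      2 ^ (N * ∑ t, faceDim (y₀ t)) * 2⁻¹ ^ (c y₀).length := by
    intro y hy
    have hy' : c y = c y₀ := hy
    have : ∀ t, faceDim (y t) = faceDim (y₀ t) := fun t => by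
      unfold faceDim; rw [hc.face y y₀ hy' t]
    simp_rw [this, hy']
  rw [setLIntegral_congr_fun (hc.measurable _) hcell, setLIntegral_const]
  calc _ ≤ (2 : ℝ≥0∞) ^ (N * ∑ t, faceDim (y₀ t)) * 2⁻¹ ^ (c y₀).length *
        2⁻¹ ^ (N * ∑ t, faceDim (y₀ t)) := by gcongr; exact pi_directSumMeasure_cell_le hc y₀
    _ = 2⁻¹ ^ (c y₀).length * (2 * 2⁻¹ : ℝ≥0∞) ^ (N * ∑ t, faceDim (y₀ t)) := by
      rw [mul_pow]; ring
    _ = _ := by rw [ENNReal.mul_inv_cancel two_ne_zero ENNReal.ofNat_ne_top, one_pow, mul_one]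

theorem measurable_code_length (hc : ∀ w, MeasurableSet (c ⁻¹' {w})) :
    Measurable fun y => (c y).length := by
  let _ : MeasurableSpace (List Bool) := ⊤
  have h1 : Measurable c := measurable_to_countable' hc
  exact (measurable_from_top (f := List.length)).comp h1

/-- Gibbs' inequality between the block density `∏ p` and the density `2^(N Σ dim - |c|)` of mass at
most one. -/
theorem mul_codeLength_le_expectedLength [IsProbabilityMeasure μ] (hp : Measurable p)
    (h0 : ∀ y, 0 ≤ p y)
    (hμ : μ = (directSumMeasure b).withDensity fun y => ENNReal.ofReal (p y))
    (hn : 0 < n) (hc : IsFaceCode b N n c) :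
    (n : EReal) * codeLength b μ p N ≤ (expectedLength μ c : EReal) := by
  have hn' : (0 : ℝ) < n := by exact_mod_cast hn
  have hnE : (n : EReal) = ((n : ℝ) : EReal) := rfl
  unfold codeLength
  rw [directSumEntropy_eq hp h0 hμ]
  by_cases hI : Integrable (fun y => p y * Real.logb 2 (p y)) (directSumMeasure b)
  swap
  · rw [entropy_of_not_integrable hp h0 hI, EReal.bot_add, hnE, EReal.coe_mul_bot_of_pos hn']
    exact bot_le
  by_cases hE : expectedLength μ c = ∞
  · rw [hE]; exact le_top
  rw [entropy_of_integrable hI, ← EReal.coe_ennreal_toReal hE, ← EReal.coe_add, hnE,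
    ← EReal.coe_mul, EReal.coe_le_coe_iff]
  set Mn := Measure.pi fun _ : Fin n => μ with hMn
  have hlen := measurable_code_length hc.measurable
  have hlenR : Measurable fun y => ((c y).length : ℝ) := (measurable_from_top (f := Nat.cast)).comp hlen
  -- the codeword length
  have hlen_eq : ∫⁻ y, ENNReal.ofReal ((c y).length : ℝ) ∂Mn = expectedLength μ c := by
    unfold expectedLength
    refine lintegral_congr fun y => ?_
    rw [ENNReal.ofReal_natCast]
  have hlen_int : Integrable (fun y => ((c y).length : ℝ)) Mn := by
    refine ⟨hlenR.aestronglyMeasurable, ?_⟩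
    rw [hasFiniteIntegral_iff_ofReal (Filter.Eventually.of_forall fun y => Nat.cast_nonneg _),
      hlen_eq]
    exact lt_top_iff_ne_top.2 hE
  have hlen_val : ∫ y, ((c y).length : ℝ) ∂Mn = (expectedLength μ c).toReal := by
    rw [integral_eq_lintegral_of_nonneg_ae (Filter.Eventually.of_forall fun y => Nat.cast_nonneg _)
      hlenR.aestronglyMeasurable, hlen_eq]
  -- the logarithm of the density
  have hpm : Measurable fun y => ENNReal.ofReal (p y) := hp.ennreal_ofReal
  have hLm : Measurable fun y => Real.logb 2 (p y) := hp.log.div_const _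
  have hL_int : Integrable (fun y => Real.logb 2 (p y)) μ := by
    rw [hμ, integrable_withDensity_iff hpm (Filter.Eventually.of_forall fun y =>
      ENNReal.ofReal_lt_top)]
    refine hI.congr (Filter.Eventually.of_forall fun y => ?_)
    simp only
    rw [ENNReal.toReal_ofReal (h0 y), mul_comm]
  have hL_val : ∫ y, Real.logb 2 (p y) ∂μ =
      ∫ y, p y * Real.logb 2 (p y) ∂(directSumMeasure b) := by
    rw [hμ, integral_withDensity_eq_integral_toReal_smul hpm
      (Filter.Eventually.of_forall fun y => ENNReal.ofReal_lt_top)]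
    refine integral_congr_ae (Filter.Eventually.of_forall fun y => ?_)
    simp only
    rw [ENNReal.toReal_ofReal (h0 y), smul_eq_mul]
  obtain ⟨hS_int, hS_val⟩ := integral_pi_sum (n := n) hL_int
  obtain ⟨hD_int, hD_val⟩ := integral_pi_sum (n := n) (integrable_faceDim (μ := μ))
  rw [integral_faceDim] at hD_val
  rw [hL_val] at hS_val
  -- `G` is the binary logarithm of the code's density over `∏ p`; the claim is that its expectation
  -- is at most zero.
  set G : (Fin n → Simplex K) → ℝ := fun y =>
    N * ∑ t, (faceDim (y t) : ℝ) - (c y).length - ∑ t, Real.logb 2 (p (y t)) with hG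
  have hG_int : Integrable G Mn := ((hD_int.const_mul _).sub hlen_int).sub hS_int
  have hG_val : ∫ y, G y ∂Mn = N * (n * meanFaceDim μ) - (expectedLength μ c).toReal -
      n * ∫ y, p y * Real.logb 2 (p y) ∂(directSumMeasure b) := by
    have h1 := integral_sub ((hD_int.const_mul (N : ℝ)).sub hlen_int) hS_int
    have h2 := integral_sub (hD_int.const_mul (N : ℝ)) hlen_int
    rw [integral_const_mul, hD_val, hlen_val] at h2
    rw [hS_val] at h1
    refine h1.trans ?_
    rw [← h2]
    rfl
  have hDm : Measurable fun y : Simplex K => (faceDim y : ℝ) := by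
    simp_rw [coe_faceDim]
    exact measurable_comp_of_finite measurableSet_preimage_faceOf fun I => (I.1.card : ℝ) - 1
  have hGm : Measurable G := by
    refine (Measurable.sub ?_ hlenR).sub ?_
    · exact (Finset.measurable_sum _ fun t _ => hDm.comp (measurable_pi_apply t)).const_mul _
    · exact Finset.measurable_sum _ fun t _ => hLm.comp (measurable_pi_apply t)
  have hexpm : Measurable fun y => (2 : ℝ) ^ G y := measurable_const.pow hGm
  -- the comparison of the two densities
  have hexp : ∫⁻ y, ENNReal.ofReal ((2 : ℝ) ^ G y) ∂Mn ≤ 1 := by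
    have : IsProbabilityMeasure ((directSumMeasure b).withDensity
      fun y => ENNReal.ofReal (p y)) := hμ ▸ inferInstance
    have hMn' : Mn = (Measure.pi fun _ : Fin n => directSumMeasure b).withDensity
        fun y => ∏ t, ENNReal.ofReal (p (y t)) := by
      rw [hMn, hμ]
      exact pi_withDensity _ hpm
    have hprod : Measurable fun y : Fin n → Simplex K => ∏ t, ENNReal.ofReal (p (y t)) :=
      Finset.measurable_prod _ fun t _ => hpm.comp (measurable_pi_apply t)
    rw [hMn', lintegral_withDensity_eq_lintegral_mul _ hprod hexpm.ennreal_ofReal]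
    refine le_trans (lintegral_mono fun y => ?_) (lintegral_kraft_le_one hc)
    simp only [Pi.mul_apply]
    -- Where some `p (y t) = 0`, the value of `G` relies on the default `logb 2 0 = 0`, but the
    -- weight `∏ p` vanishes there.
    by_cases hy : ∀ t, 0 < p (y t)
    · have h1 : (2 : ℝ) ^ (∑ t, Real.logb 2 (p (y t))) = ∏ t, p (y t) := by
        rw [Real.rpow_sum_of_pos two_pos]
        exact Finset.prod_congr rfl fun t _ => Real.rpow_logb two_pos (by norm_num) (hy t)
      have hpos : 0 < ∏ t, p (y t) := Finset.prod_pos fun t _ => hy t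
      have h2 : (∏ t, p (y t)) * (2 : ℝ) ^ G y =
          2 ^ (N * ∑ t, faceDim (y t)) * 2⁻¹ ^ (c y).length := by
        have h3 : (N : ℝ) * ∑ t, (faceDim (y t) : ℝ) = ((N * ∑ t, faceDim (y t) : ℕ) : ℝ) := by
          push_cast; rfl
        simp only [hG]
        rw [h3, Real.rpow_sub two_pos, Real.rpow_sub two_pos, h1, mul_div_cancel₀ _ hpos.ne',
          Real.rpow_natCast, Real.rpow_natCast, inv_pow, div_eq_mul_inv]
      rw [← ENNReal.ofReal_prod_of_nonneg fun t _ => (hy t).le,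
        ← ENNReal.ofReal_mul hpos.le, h2, ENNReal.ofReal_mul (by positivity),
        ENNReal.ofReal_pow two_pos.le, ENNReal.ofReal_pow (by positivity),
        ENNReal.ofReal_inv_of_pos two_pos, ENNReal.ofReal_ofNat]
    · push Not at hy
      obtain ⟨t, ht⟩ := hy
      rw [Finset.prod_eq_zero (Finset.mem_univ t) (ENNReal.ofReal_of_nonpos ht), zero_mul]
      exact zero_le
  have hexp_int : Integrable (fun y => (2 : ℝ) ^ G y) Mn := by
    refine ⟨hexpm.aestronglyMeasurable, ?_⟩
    rw [hasFiniteIntegral_iff_ofReal (Filter.Eventually.of_forall fun y => by positivity)]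
    exact hexp.trans_lt ENNReal.one_lt_top
  have hexp_val : ∫ y, (2 : ℝ) ^ G y ∂Mn ≤ 1 := by
    rw [integral_eq_lintegral_of_nonneg_ae (Filter.Eventually.of_forall fun y => by positivity)
      hexpm.aestronglyMeasurable]
    exact ENNReal.toReal_le_of_le_ofReal zero_le_one (by simpa using hexp)
  have hlog2 : 0 < Real.log 2 := Real.log_pos one_lt_two
  -- The tangent bound `1 + u ≤ exp u` takes the place of Jensen's inequality.
  have hle : ∫ y, (1 + Real.log 2 * G y) ∂Mn ≤ ∫ y, (2 : ℝ) ^ G y ∂Mn := by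
    refine integral_mono ((integrable_const _).add (hG_int.const_mul _)) hexp_int fun y => ?_
    have := Real.add_one_le_exp (Real.log 2 * G y)
    simp only
    rw [Real.rpow_def_of_pos two_pos]
    linarith
  rw [integral_add (integrable_const _) (hG_int.const_mul _), integral_const_mul] at hle
  simp only [integral_const, probReal_univ, smul_eq_mul, mul_one] at hle
  have hG_le : ∫ y, G y ∂Mn ≤ 0 := by
    by_contra h
    push Not at h
    have := mul_pos hlog2 h
    linarith
  rw [hG_val] at hG_le
  linarith

end LowerBound

/-! ### Dyadic cubes, Lebesgue differentiation and Fatou's lemma -/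

section Dyadic

variable {ι : Type*}

/-- The half-open dyadic cube of side `2 ^ (-N)` with index `k`. -/
def dyadicCube (N : ℕ) (k : ι → ℕ) : Set (ι → ℝ) :=
  Set.univ.pi fun i => Set.Ico ((k i : ℝ) / 2 ^ N) (((k i : ℝ) + 1) / 2 ^ N)

/-- The index of the dyadic cube that contains a point with nonnegative coordinates. -/
noncomputable def dyadicIndex (N : ℕ) (x : ι → ℝ) : ι → ℕ := fun i => ⌊2 ^ N * x i⌋₊

theorem mem_dyadicCube_iff {N : ℕ} {k : ι → ℕ} {x : ι → ℝ} (hx : ∀ i, 0 ≤ x i) :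
    x ∈ dyadicCube N k ↔ dyadicIndex N x = k := by
  have h2 : (0 : ℝ) < 2 ^ N := by positivity
  simp only [dyadicCube, Set.mem_univ_pi, Set.mem_Ico, dyadicIndex, funext_iff]
  refine forall_congr' fun i => ?_
  rw [Nat.floor_eq_iff (mul_nonneg h2.le (hx i)), div_le_iff₀' h2, lt_div_iff₀' h2]

theorem nonneg_of_mem_dyadicCube {N : ℕ} {k : ι → ℕ} {x : ι → ℝ} (hx : x ∈ dyadicCube N k)
    (i : ι) : 0 ≤ x i :=
  le_trans (by positivity) (hx i trivial).1

theorem abs_sub_le_of_mem_dyadicCube {N : ℕ} {k : ι → ℕ} {x y : ι → ℝ} (hx : x ∈ dyadicCube N k)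
    (hy : y ∈ dyadicCube N k) (i : ι) : |x i - y i| ≤ 2⁻¹ ^ N := by
  have h1 := hx i trivial
  have h2 := hy i trivial
  have h3 : ((k i : ℝ) + 1) / 2 ^ N = (k i : ℝ) / 2 ^ N + 2⁻¹ ^ N := by
    rw [inv_pow, add_div, one_div]
  rw [Set.mem_Ico, h3] at h1 h2
  rw [abs_le]
  constructor <;> linarith [h1.1, h1.2, h2.1, h2.2]

theorem dyadicIndex_lt {N : ℕ} {x : ι → ℝ} (hx : x ∈ unitCube ι) (i : ι) :
    dyadicIndex N x i < 2 ^ N := by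
  have h2 : (0 : ℝ) < 2 ^ N := by positivity
  have h := hx i trivial
  rw [dyadicIndex, Nat.floor_lt (mul_nonneg h2.le h.1)]
  push_cast
  nlinarith [h.2]

theorem iUnion_dyadicCube (N : ℕ) :
    ⋃ k : ι → Fin (2 ^ N), dyadicCube N (fun i => (k i : ℕ)) = unitCube ι := by
  have h2 : (0 : ℝ) < 2 ^ N := by positivity
  ext x
  rw [Set.mem_iUnion]
  constructor
  · rintro ⟨k, hk⟩ i _
    refine ⟨nonneg_of_mem_dyadicCube hk i, (hk i trivial).2.trans_le ?_⟩
    rw [div_le_one h2]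
    exact_mod_cast (k i).2
  · intro hx
    exact ⟨fun i => ⟨dyadicIndex N x i, dyadicIndex_lt hx i⟩,
      (mem_dyadicCube_iff fun i => (hx i trivial).1).2 rfl⟩

theorem disjoint_dyadicCube (N : ℕ) :
    Pairwise (Function.onFun Disjoint
      fun k : ι → Fin (2 ^ N) => dyadicCube N fun i => (k i : ℕ)) := by
  intro k k' hkk
  refine Set.disjoint_left.2 fun x hx hx' => hkk ?_
  have h0 := nonneg_of_mem_dyadicCube hx
  have := ((mem_dyadicCube_iff h0).1 hx).symm.trans ((mem_dyadicCube_iff h0).1 hx')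
  funext i
  exact Fin.ext (congrFun this i)

theorem measurable_dyadicIndex (N : ℕ) : Measurable (dyadicIndex N : (ι → ℝ) → ι → ℕ) :=
  measurable_pi_iff.2 fun i =>
    Nat.measurable_floor.comp ((measurable_pi_apply i).const_mul _)

variable [Fintype ι]

theorem measurableSet_dyadicCube (N : ℕ) (k : ι → ℕ) : MeasurableSet (dyadicCube N k) :=
  MeasurableSet.univ_pi fun _ => measurableSet_Ico

theorem volume_dyadicCube (N : ℕ) (k : ι → ℕ) :
    volume (dyadicCube N k) = ENNReal.ofReal (2⁻¹ ^ (N * Fintype.card ι)) := by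
  rw [dyadicCube, volume_pi_pi]
  simp_rw [Real.volume_Ico]
  have : ∀ i, ((k i : ℝ) + 1) / 2 ^ N - (k i : ℝ) / 2 ^ N = 2⁻¹ ^ N := fun i => by
    rw [inv_pow, add_div, one_div]; ring
  simp_rw [this]
  rw [Finset.prod_const, Finset.card_univ, ← ENNReal.ofReal_pow (by positivity), pow_mul]

/-- In the sup norm a closed cube is a ball about its centre, and the faces missing from the
half-open cube are null. -/
theorem closedBall_ae_eq_dyadicCube (N : ℕ) (k : ι → ℕ) :
    (Metric.closedBall (fun i => ((k i : ℝ) + 1 / 2) / 2 ^ N) (1 / 2 / 2 ^ N) : Set (ι → ℝ))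
      =ᵐ[volume] dyadicCube N k := by
  have h : (Metric.closedBall (fun i => ((k i : ℝ) + 1 / 2) / 2 ^ N) (1 / 2 / 2 ^ N) :
      Set (ι → ℝ)) =
      Set.Icc (fun i => (k i : ℝ) / 2 ^ N) (fun i => ((k i : ℝ) + 1) / 2 ^ N) := by
    rw [closedBall_pi _ (by positivity), ← Set.pi_univ_Icc]
    congr 1
    funext i
    rw [Real.closedBall_eq_Icc, ← sub_div, ← add_div]
    congr 2 <;> ring
  rw [h]
  exact Measure.univ_pi_Ico_ae_eq_Icc.symm

/-- The averages of a function over the dyadic cubes. -/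
noncomputable def dyadicAverage (q : (ι → ℝ) → ℝ) (N : ℕ) (k : ι → ℕ) : ℝ :=
  2 ^ (N * Fintype.card ι) * ∫ x in dyadicCube N k, q x

theorem average_closedBall_eq (q : (ι → ℝ) → ℝ) (N : ℕ) (k : ι → ℕ) :
    ⨍ x in Metric.closedBall (fun i => ((k i : ℝ) + 1 / 2) / 2 ^ N) (1 / 2 / 2 ^ N), q x =
      dyadicAverage q N k := by
  have h := closedBall_ae_eq_dyadicCube N k
  rw [setAverage_eq, setIntegral_congr_set h, measureReal_congr h, measureReal_def,
    volume_dyadicCube, ENNReal.toReal_ofReal (by positivity), inv_pow, inv_inv, smul_eq_mul,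
    dyadicAverage]

/-- Lebesgue differentiation for shrinking balls that contain `x` without being centred at it. -/
theorem ae_tendsto_dyadicAverage {q : (ι → ℝ) → ℝ} (hq : Integrable q) :
    ∀ᵐ x : ι → ℝ, (∀ i, 0 ≤ x i) →
      Filter.Tendsto (fun N => dyadicAverage q N (dyadicIndex N x)) Filter.atTop (nhds (q x)) := by
  filter_upwards [IsUnifLocDoublingMeasure.ae_tendsto_average volume hq.locallyIntegrable 1]
    with x hx h0
  have h := hx (l := Filter.atTop)
    (fun (N : ℕ) i => ((dyadicIndex N x i : ℝ) + 1 / 2) / 2 ^ N) (fun N => 1 / 2 / 2 ^ N) ?_ ?_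
  · simpa only [average_closedBall_eq] using h
  · refine tendsto_nhdsWithin_iff.2 ⟨?_, Filter.Eventually.of_forall fun N => ?_⟩
    · have := (tendsto_pow_atTop_nhds_zero_of_lt_one (r := (2⁻¹ : ℝ)) (by norm_num)
        (by norm_num)).const_mul (1 / 2)
      simpa [div_eq_mul_inv] using this
    · simp only [Set.mem_Ioi]; positivity
  · refine Filter.Eventually.of_forall fun N => ?_
    have hm := (mem_dyadicCube_iff (N := N) h0).2 rfl
    rw [one_mul, closedBall_pi _ (by positivity)]
    intro i _
    have := hm i trivial
    simp only
    rw [Real.closedBall_eq_Icc, ← sub_div, ← add_div]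
    refine ⟨le_trans (le_of_eq ?_) this.1, this.2.le.trans (le_of_eq ?_)⟩ <;> ring

theorem setLIntegral_unitCube_dyadicIndex [DecidableEq ι] (N : ℕ) (F : (ι → ℕ) → ℝ≥0∞) :
    ∫⁻ x in unitCube ι, F (dyadicIndex N x) =
      ∑ k : ι → Fin (2 ^ N), F (fun i => k i) * ENNReal.ofReal (2⁻¹ ^ (N * Fintype.card ι)) := by
  rw [← iUnion_dyadicCube N, lintegral_iUnion (fun k => measurableSet_dyadicCube _ _)
    (disjoint_dyadicCube N), tsum_fintype]
  refine Finset.sum_congr rfl fun k _ => ?_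
  rw [setLIntegral_congr_fun (g := fun _ => F fun i => k i) (measurableSet_dyadicCube _ _),
    setLIntegral_const, volume_dyadicCube]
  intro x hx
  simp only
  rw [(mem_dyadicCube_iff (nonneg_of_mem_dyadicCube hx)).1 hx]

theorem continuous_mul_logb : Continuous fun x : ℝ => x * Real.logb 2 x := by
  have h : (fun x : ℝ => x * Real.logb 2 x) = fun x => x * Real.log x / Real.log 2 := by
    funext x; rw [Real.logb, mul_div_assoc]
  rw [h]
  exact Real.continuous_mul_log.div_const _

/-- Fatou's lemma for the entropy integrals of the dyadic averages. -/
theorem lintegral_le_liminf_dyadicAverage [DecidableEq ι] {q : (ι → ℝ) → ℝ} (hq : Integrable q) :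
    ∫⁻ x in unitCube ι, ENNReal.ofReal (1 + q x * Real.logb 2 (q x)) ≤
      Filter.liminf (fun N : ℕ => ∑ k : ι → Fin (2 ^ N),
        ENNReal.ofReal (1 + dyadicAverage q N (fun i => k i) *
          Real.logb 2 (dyadicAverage q N fun i => k i)) *
        ENNReal.ofReal (2⁻¹ ^ (N * Fintype.card ι))) Filter.atTop := by
  set F : ℕ → (ι → ℕ) → ℝ≥0∞ := fun N k =>
    ENNReal.ofReal (1 + dyadicAverage q N k * Real.logb 2 (dyadicAverage q N k)) with hF
  have hFm : ∀ N, Measurable fun x : ι → ℝ => F N (dyadicIndex N x) := fun N =>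
    (measurable_of_countable (F N)).comp (measurable_dyadicIndex N)
  have hae : ∀ᵐ x ∂(volume.restrict (unitCube ι)),
      ENNReal.ofReal (1 + q x * Real.logb 2 (q x)) =
        Filter.liminf (fun N => F N (dyadicIndex N x)) Filter.atTop := by
    rw [ae_restrict_iff' (measurableSet_unitCube ι)]
    filter_upwards [ae_tendsto_dyadicAverage hq] with x hx hxU
    have h1 := hx fun i => (hxU i trivial).1
    -- Continuity at `t = 0` matters too, because the limiting density may vanish.
    have h2 : Continuous fun t : ℝ => ENNReal.ofReal (1 + t * Real.logb 2 t) :=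
      ENNReal.continuous_ofReal.comp (continuous_const.add continuous_mul_logb)
    exact ((h2.tendsto _).comp h1).liminf_eq.symm
  rw [lintegral_congr_ae hae]
  refine (lintegral_liminf_le hFm).trans (le_of_eq ?_)
  simp_rw [setLIntegral_unitCube_dyadicIndex, hF]

end Dyadic

/-- Fatou's lemma for counting measure; it combines the limits on the separate faces. -/
theorem sum_liminf_le {ι : Type*} [Fintype ι] (f : ℕ → ι → ℝ≥0∞) :
    ∑ i, Filter.liminf (fun N => f N i) Filter.atTop ≤
      Filter.liminf (fun N => ∑ i, f N i) Filter.atTop := by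
  let _ : MeasurableSpace ι := ⊤
  have := lintegral_liminf_le (μ := Measure.count) (f := f) (u := Filter.atTop) fun N => measurable_from_top
  simpa only [lintegral_count, tsum_fintype] using this

/-! ### Entropy of the quantized point -/

section Cells

/-- The quantization cell of a face with a given dyadic cube of free coordinates. -/
def cell (b : Elim K) (N : ℕ) (I : Face K) (k : Free b I → Fin (2 ^ N)) : Set (Simplex K) :=
  relInt I ∩ freeCoord b I ⁻¹' dyadicCube N fun i => (k i : ℕ)

theorem measurableSet_cell (N : ℕ) (I : Face K) (k : Free b I → Fin (2 ^ N)) :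
    MeasurableSet (cell b N I k) :=
  (measurableSet_relInt I).inter (measurable_freeCoord b I (measurableSet_dyadicCube _ _))

theorem freeCoord_mem_unitCube {I : Face K} {y : Simplex K} (hy : y ∈ relInt I) :
    freeCoord b I y ∈ unitCube (Free b I) := by
  intro i _
  refine ⟨y.2.1 i, ?_⟩
  -- Positivity of the eliminated coordinate makes the free ones strictly less than 1, as the
  -- half-open cube requires.
  have hb : 0 < y.1 (b I) := by
    rw [← mem_supp, show supp y = I.1 from hy]
    exact (b I).2
  have h := Finset.add_le_sum (s := Finset.univ) (f := y.1) (fun j _ => y.2.1 j)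
    (Finset.mem_univ (i : Fin K)) (Finset.mem_univ (b I : Fin K)) i.2.2
  rw [y.2.2] at h
  change y.1 i < 1
  linarith

theorem relInt_eq_iUnion_cell (N : ℕ) (I : Face K) : relInt I = ⋃ k, cell b N I k := by
  simp_rw [cell]
  rw [← Set.inter_iUnion, ← Set.preimage_iUnion, iUnion_dyadicCube, eq_comm, Set.inter_eq_left]
  exact fun y hy => freeCoord_mem_unitCube hy

theorem sum_measureReal_cell [IsFiniteMeasure μ] (N : ℕ) (I : Face K) :
    ∑ k, μ.real (cell b N I k) = faceProb μ I := by
  rw [faceProb, relInt_eq_iUnion_cell (b := b) N I, measureReal_iUnion_fintype]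
  · intro k k' hkk
    exact ((disjoint_dyadicCube N hkk).preimage _).mono Set.inter_subset_right
      Set.inter_subset_right
  · exact fun k => measurableSet_cell N I k

theorem integrable_inChart [IsProbabilityMeasure μ] (hp : Measurable p) (h0 : ∀ y, 0 ≤ p y)
    (hμ : μ = (directSumMeasure b).withDensity fun y => ENNReal.ofReal (p y)) (I : Face K) :
    Integrable (inChart b I p) := by
  have hi : Integrable p (faceMeasure b I) := by
    rw [← directSumMeasure_restrict b I]; exact (integrable_density hp h0 hμ).restrict
  have hnn : ∀ x, 0 ≤ inChart b I p x := fun x => by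
    rcases inChart_eq_zero_or b I p x with ⟨-, h⟩ | ⟨y, -, -, h, -⟩ <;> rw [h]
    exact h0 y
  refine ⟨(measurable_inChart b I hp).aestronglyMeasurable, ?_⟩
  rw [hasFiniteIntegral_iff_ofReal (Filter.Eventually.of_forall hnn)]
  have h := hi.lintegral_lt_top
  rw [lintegral_faceMeasure b I hp.ennreal_ofReal] at h
  refine lt_of_le_of_lt (lintegral_mono fun x => ?_) h
  rcases inChart_eq_zero_or b I p x with ⟨-, h⟩ | ⟨y, -, -, h, h'⟩
  · simp [h]
  · simp only
    rw [h, h' fun y => ENNReal.ofReal (p y)]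

theorem measureReal_cell (hp : Measurable p) (h0 : ∀ y, 0 ≤ p y)
    (hμ : μ = (directSumMeasure b).withDensity fun y => ENNReal.ofReal (p y)) (N : ℕ) (I : Face K)
    (k : Free b I → Fin (2 ^ N)) :
    μ.real (cell b N I k) = ∫ x in dyadicCube N (fun i => (k i : ℕ)), inChart b I p x := by
  have hnn : ∀ x, 0 ≤ inChart b I p x := fun x => by
    rcases inChart_eq_zero_or b I p x with ⟨-, h⟩ | ⟨y, -, -, h, -⟩ <;> rw [h]
    exact h0 y
  set D := dyadicCube N fun i : Free b I => (k i : ℕ) with hD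
  have hDm : MeasurableSet D := measurableSet_dyadicCube _ _
  have hpre := measurable_freeCoord b I hDm
  rw [integral_eq_lintegral_of_nonneg_ae (Filter.Eventually.of_forall hnn)
    (measurable_inChart b I hp).aestronglyMeasurable, measureReal_def, cell, Set.inter_comm]
  congr 1
  have h1 : μ (freeCoord b I ⁻¹' D ∩ relInt I) =
      ∫⁻ y, (freeCoord b I ⁻¹' D).indicator (fun y => ENNReal.ofReal (p y)) y
        ∂(faceMeasure b I) := by
    rw [hμ, withDensity_apply _ (hpre.inter (measurableSet_relInt I)),
      ← Measure.restrict_restrict hpre, directSumMeasure_restrict, lintegral_indicator hpre]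
  rw [h1, lintegral_faceMeasure b I (hp.ennreal_ofReal.indicator hpre), ← lintegral_indicator hDm]
  refine lintegral_congr fun x => ?_
  rcases inChart_eq_zero_or b I p x with ⟨hx, h⟩ | ⟨y, -, rfl, h, h'⟩
  · rw [inChart_of_notMem b I _ hx]
    by_cases hxD : x ∈ D <;> simp [hxD, h]
  · rw [h']
    by_cases hy : freeCoord b I y ∈ D
    · rw [Set.indicator_of_mem hy, Set.indicator_of_mem (show y ∈ freeCoord b I ⁻¹' D from hy), h]
    · rw [Set.indicator_of_notMem hy,
        Set.indicator_of_notMem (show y ∉ freeCoord b I ⁻¹' D from hy)]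

/-- Extension by zero to the cube leaves the entropy unchanged because `0 log 0 = 0`; the leading 1
is the volume of the cube. -/
theorem entropy_faceMeasure_eq (hp : Measurable p) (h0 : ∀ y, 0 ≤ p y) (I : Face K) :
    entropy (faceMeasure b I) p = ((1 : ℝ) : EReal) -
      ((∫⁻ x in unitCube (Free b I), ENNReal.ofReal (1 + inChart b I p x *
        Real.logb 2 (inChart b I p x)) : ℝ≥0∞) : EReal) := by
  have hnn : ∀ x, 0 ≤ inChart b I p x := fun x => by
    rcases inChart_eq_zero_or b I p x with ⟨-, h⟩ | ⟨y, -, -, h, -⟩ <;> rw [h]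
    exact h0 y
  have : IsFiniteMeasure (volume.restrict (unitCube (Free b I))) :=
    ⟨by rw [Measure.restrict_apply_univ, volume_unitCube]; exact ENNReal.one_lt_top⟩
  have h1 : entropy (faceMeasure b I) p =
      entropy (volume.restrict (unitCube (Free b I))) (inChart b I p) := by
    have hm := measurable_mul_logb hp
    unfold entropy
    rw [lintegral_faceMeasure_unitCube b I hm.ennreal_ofReal,
      lintegral_faceMeasure_unitCube b I (f := fun y => ENNReal.ofReal
        (-(p y * Real.logb 2 (p y)))) hm.neg.ennreal_ofReal]
    congr 3 <;> funext x
    · rcases inChart_eq_zero_or b I p x with ⟨hx, h⟩ | ⟨y, -, -, h, h'⟩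
      · rw [inChart_of_notMem b I _ hx, h]; simp
      · rw [h', h]
    · rcases inChart_eq_zero_or b I p x with ⟨hx, h⟩ | ⟨y, -, -, h, h'⟩
      · rw [inChart_of_notMem b I _ hx, h]; simp
      · rw [h', h]
  rw [h1, entropy_eq_sub (measurable_inChart b I hp) hnn]
  congr 2
  rw [measureReal_def, Measure.restrict_apply_univ, volume_unitCube, ENNReal.toReal_one]

theorem dyadicAverage_inChart (hp : Measurable p) (h0 : ∀ y, 0 ≤ p y)
    (hμ : μ = (directSumMeasure b).withDensity fun y => ENNReal.ofReal (p y)) (N : ℕ) (I : Face K)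
    (k : Free b I → Fin (2 ^ N)) :
    dyadicAverage (inChart b I p) N (fun i => k i) =
      2 ^ (N * Fintype.card (Free b I)) * μ.real (cell b N I k) := by
  rw [dyadicAverage, measureReal_cell hp h0 hμ]

theorem one_add_mul_logb_nonneg {x : ℝ} (hx : 0 ≤ x) : 0 ≤ 1 + x * Real.logb 2 x := by
  linarith [neg_one_le_mul_logb hx]

/-- For a cell of mass `m > 0`, `log₂ (2^M m) = M + log₂ m`. The `2^M` cells of weight `2^(-M)`
contribute the 1, and `M` times the total mass is the face's share of `N d`. -/
theorem sum_scaled_cell_eq [IsFiniteMeasure μ] (N : ℕ) (I : Face K) {M : ℕ}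
    (hM : M = N * Fintype.card (Free b I)) :
    ∑ k, (1 + 2 ^ M * μ.real (cell b N I k) * Real.logb 2 (2 ^ M * μ.real (cell b N I k))) *
        2⁻¹ ^ M =
      1 + ∑ k, μ.real (cell b N I k) * Real.logb 2 (μ.real (cell b N I k)) +
        N * (((I.1.card : ℝ) - 1) * faceProb μ I) := by
  have hMr : (M : ℝ) = N * ((I.1.card : ℝ) - 1) := by
    rw [hM, card_free]
    push_cast
    rw [Nat.cast_sub (Finset.card_pos.2 I.2), Nat.cast_one]
  have h2 : (0 : ℝ) < 2 ^ M := by positivity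
  have hterm : ∀ k : Free b I → Fin (2 ^ N), (1 + 2 ^ M * μ.real (cell b N I k) *
      Real.logb 2 (2 ^ M * μ.real (cell b N I k))) * 2⁻¹ ^ M =
      2⁻¹ ^ M + μ.real (cell b N I k) * Real.logb 2 (μ.real (cell b N I k)) +
        M * μ.real (cell b N I k) := fun k => by
    have h3 : (2 : ℝ) ^ M * 2⁻¹ ^ M = 1 := by rw [← mul_pow]; norm_num
    rcases (measureReal_nonneg (μ := μ) (s := cell b N I k)).eq_or_lt with h | h
    · rw [← h]; simp
    · rw [Real.logb_mul h2.ne' h.ne', Real.logb_pow, Real.logb_self_eq_one one_lt_two]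
      linear_combination (μ.real (cell b N I k) * (M + Real.logb 2 (μ.real (cell b N I k)))) * h3
  simp_rw [hterm]
  rw [Finset.sum_add_distrib, Finset.sum_add_distrib, ← Finset.mul_sum, sum_measureReal_cell, hMr]
  have h4 : ∑ _k : Free b I → Fin (2 ^ N), (2⁻¹ : ℝ) ^ M = 1 := by
    rw [Finset.sum_const, Finset.card_univ, Fintype.card_fun, Fintype.card_fin, nsmul_eq_mul,
      ← pow_mul, ← hM]
    push_cast
    rw [← mul_pow]; norm_num
  rw [h4]
  ring

/-- The quantized entropy of a face, in terms of the dyadic averages. -/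
theorem sum_dyadicAverage_eq [IsFiniteMeasure μ] (hp : Measurable p) (h0 : ∀ y, 0 ≤ p y)
    (hμ : μ = (directSumMeasure b).withDensity fun y => ENNReal.ofReal (p y)) (N : ℕ)
    (I : Face K) :
    ∑ k : Free b I → Fin (2 ^ N),
        ENNReal.ofReal (1 + dyadicAverage (inChart b I p) N (fun i => k i) *
          Real.logb 2 (dyadicAverage (inChart b I p) N fun i => k i)) *
        ENNReal.ofReal (2⁻¹ ^ (N * Fintype.card (Free b I))) =
      ENNReal.ofReal (1 + ∑ k, μ.real (cell b N I k) * Real.logb 2 (μ.real (cell b N I k)) +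
        N * (((I.1.card : ℝ) - 1) * faceProb μ I)) := by
  simp_rw [dyadicAverage_inChart hp h0 hμ]
  have hnn : ∀ k : Free b I → Fin (2 ^ N), 0 ≤ 1 + 2 ^ (N * Fintype.card (Free b I)) *
      μ.real (cell b N I k) * Real.logb 2 (2 ^ (N * Fintype.card (Free b I)) *
        μ.real (cell b N I k)) := fun k => one_add_mul_logb_nonneg (by positivity)
  simp_rw [← ENNReal.ofReal_mul (hnn _)]
  rw [← ENNReal.ofReal_sum_of_nonneg fun k _ => mul_nonneg (hnn k) (by positivity),
    sum_scaled_cell_eq N I rfl]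

/-- The entropy of the quantized point is eventually below `B + N * d`. -/
theorem eventually_quantized_entropy_lt [IsProbabilityMeasure μ] (hp : Measurable p)
    (h0 : ∀ y, 0 ≤ p y)
    (hμ : μ = (directSumMeasure b).withDensity fun y => ENNReal.ofReal (p y)) {B : ℝ}
    (hB : directSumEntropy b μ p < B) :
    ∀ᶠ N : ℕ in Filter.atTop,
      -∑ I : Face K, ∑ k, μ.real (cell b N I k) * Real.logb 2 (μ.real (cell b N I k)) <
        B + N * meanFaceDim μ := by
  set J : Face K → ℝ≥0∞ := fun I => ∫⁻ x in unitCube (Free b I), ENNReal.ofReal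
    (1 + inChart b I p x * Real.logb 2 (inChart b I p x)) with hJ
  set T : ℕ → Face K → ℝ := fun N I =>
    1 + ∑ k, μ.real (cell b N I k) * Real.logb 2 (μ.real (cell b N I k)) +
      N * (((I.1.card : ℝ) - 1) * faceProb μ I) with hT
  have hJT : ∑ I, J I ≤ Filter.liminf (fun N => ∑ I, ENNReal.ofReal (T N I)) Filter.atTop := by
    refine le_trans (Finset.sum_le_sum fun I _ => ?_)
      (sum_liminf_le fun N I => ENNReal.ofReal (T N I))
    refine (lintegral_le_liminf_dyadicAverage (integrable_inChart hp h0 hμ I)).trans (le_of_eq ?_)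
    simp_rw [sum_dyadicAverage_eq hp h0 hμ, hT]
  have hTnn : ∀ N I, 0 ≤ T N I := by
    intro N I
    rw [hT]
    simp only
    rw [← sum_scaled_cell_eq N I rfl]
    exact Finset.sum_nonneg fun k _ =>
      mul_nonneg (one_add_mul_logb_nonneg (by positivity)) (by positivity)
  rw [directSumEntropy_eq_sum hp h0 hμ, Finset.sum_congr rfl fun I _ =>
    entropy_faceMeasure_eq hp h0 I, sum_coe_sub_coe_ennreal] at hB
  simp only [Finset.sum_const, Finset.card_univ, nsmul_eq_mul, mul_one] at hB
  -- One unit for each face, from the leading 1 in `entropy_faceMeasure_eq`; these cancel against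
  -- the same units in `T`.
  set C : ℝ := (Fintype.card (Face K) : ℝ) with hC
  have hlt : ∀ᶠ N : ℕ in Filter.atTop, C - B < ∑ I, T N I := by
    rcases lt_or_ge (C - B) 0 with h | h
    · exact Filter.Eventually.of_forall fun N =>
        h.trans_le (Finset.sum_nonneg fun I _ => hTnn N I)
    -- This also covers `∑ J = ∞`, the case of entropy `-∞`.
    · have h1 : ENNReal.ofReal (C - B) < ∑ I, J I := by
        by_contra hle
        push Not at hle
        have hne : ∑ I, J I ≠ ∞ := (hle.trans_lt ENNReal.ofReal_lt_top).ne
        have h2 := ENNReal.toReal_le_of_le_ofReal h hle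
        rw [← EReal.coe_ennreal_toReal hne, ← EReal.coe_sub, EReal.coe_lt_coe_iff] at hB
        linarith
      filter_upwards [Filter.eventually_lt_of_lt_liminf (h1.trans_le hJT)] with N hN
      rw [← ENNReal.ofReal_sum_of_nonneg fun I _ => hTnn N I] at hN
      exact (ENNReal.ofReal_lt_ofReal_iff_of_nonneg h).1 hN
  filter_upwards [hlt] with N hN
  rw [hT] at hN
  simp only [Finset.sum_add_distrib, ← Finset.mul_sum, ← meanFaceDim_eq_sum] at hN
  simp only [Finset.sum_const, Finset.card_univ, nsmul_eq_mul, mul_one] at hN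
  linarith

end Cells

/-! ### Shannon block codes -/

section Shannon

/-- Block coding of a finite-valued function of independent points, with a Shannon code for an
arbitrary product distribution of full support. -/
theorem exists_shannon_code {X A : Type*} [MeasurableSpace X] (μ : Measure X)
    [IsProbabilityMeasure μ] [Fintype A] {g : X → A} (hg : ∀ a, MeasurableSet (g ⁻¹' {a}))
    {Q : A → ℝ} (hQ : ∀ a, 0 < Q a) (hQ1 : ∑ a, Q a ≤ 1) (n : ℕ) :
    ∃ code : (Fin n → A) → List Bool, Function.Injective code ∧
      PrefixFree (Set.range code) ∧ [] ∉ Set.range code ∧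
      ∫⁻ y, ((code fun t => g (y t)).length : ℝ≥0∞) ∂(Measure.pi fun _ : Fin n => μ) ≤
        ENNReal.ofReal (n * ∑ a, -Real.logb 2 (Q a) * μ.real (g ⁻¹' {a}) + 1) := by
  have hQle : ∀ a, Q a ≤ 1 := fun a =>
    (Finset.single_le_sum (fun a _ => (hQ a).le) (Finset.mem_univ a)).trans hQ1
  set h : A → ℝ := fun a => -Real.logb 2 (Q a) with hh
  have h0 : ∀ a, 0 ≤ h a := fun a =>
    neg_nonneg.2 (Real.logb_nonpos one_lt_two (hQ a).le (hQle a))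
  -- Floor plus one instead of the ceiling: Kraft's inequality and the one-bit overhead survive, and
  -- no codeword is empty, even for zero information content.
  set l : (Fin n → A) → ℕ := fun a => ⌊∑ t, h (a t)⌋₊ + 1 with hl
  have hkraft : ∑ a, (2⁻¹ : ℝ) ^ l a ≤ 1 := by
    calc ∑ a, (2⁻¹ : ℝ) ^ l a ≤ ∑ a : Fin n → A, ∏ t, Q (a t) := by
          refine Finset.sum_le_sum fun a _ => ?_
          have h1 : ∏ t, Q (a t) = (2 : ℝ) ^ (-∑ t, h (a t)) := by
            rw [← Finset.sum_neg_distrib, Real.rpow_sum_of_pos two_pos]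
            refine Finset.prod_congr rfl fun t _ => ?_
            rw [hh]
            simp only [neg_neg]
            rw [Real.rpow_logb two_pos (by norm_num) (hQ _)]
          have h2 : (2⁻¹ : ℝ) ^ l a = (2 : ℝ) ^ (-(l a : ℝ)) := by
            rw [Real.rpow_neg two_pos.le, Real.rpow_natCast, inv_pow]
          rw [h1, h2]
          refine Real.rpow_le_rpow_of_exponent_le one_le_two (neg_le_neg ?_)
          rw [hl]
          push_cast
          exact (Nat.lt_floor_add_one _).le
      _ = (∑ a, Q a) ^ n := (Fintype.sum_pow Q n).symm
      _ ≤ 1 := pow_le_one₀ (Finset.sum_nonneg fun a _ => (hQ a).le) hQ1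
  obtain ⟨code, hlen, hpre⟩ := exists_code_of_kraft l hkraft
  refine ⟨code, fun a a' h => hpre a a' (h ▸ List.prefix_rfl), ?_, ?_, ?_⟩
  · rintro _ ⟨a, rfl⟩ _ ⟨a', rfl⟩ h
    rw [hpre a a' h]
  · rintro ⟨a, ha⟩
    have := hlen a
    rw [ha, hl] at this
    simp at this
  · obtain ⟨hi, hv⟩ := integral_pi_sum (n := n) (integrable_comp_of_finite μ hg h)
    rw [integral_comp_of_finite μ hg h] at hv
    calc _ ≤ ∫⁻ y, ENNReal.ofReal (∑ t, h (g (y t)) + 1)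
          ∂(Measure.pi fun _ : Fin n => μ) := by
          refine lintegral_mono fun y => ?_
          rw [hlen, ← ENNReal.ofReal_natCast]
          refine ENNReal.ofReal_le_ofReal ?_
          rw [hl]
          push_cast
          linarith [Nat.floor_le (Finset.sum_nonneg fun t (_ : t ∈ Finset.univ) => h0 (g (y t)))]
      _ = ENNReal.ofReal (∫ y, (∑ t, h (g (y t)) + 1) ∂(Measure.pi fun _ : Fin n => μ)) := by
          refine (ofReal_integral_eq_lintegral_ofReal (hi.add (integrable_const 1)) ?_).symm
          exact Filter.Eventually.of_forall fun y =>
            add_nonneg (Finset.sum_nonneg fun t _ => h0 _) zero_le_one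
      _ = _ := by
          rw [integral_add hi (integrable_const _), hv, integral_const, probReal_univ, one_smul]

/-- A full-support distribution whose cross entropy exceeds the entropy by at most `δ`. -/
theorem exists_distribution_cross_entropy_le {A : Type*} [Fintype A] {m : A → ℝ}
    (hm : ∀ a, 0 ≤ m a) (hm1 : ∑ a, m a = 1) {δ : ℝ} (hδ : 0 < δ) :
    ∃ Q : A → ℝ, (∀ a, 0 < Q a) ∧ ∑ a, Q a ≤ 1 ∧
      ∑ a, -Real.logb 2 (Q a) * m a ≤ -∑ a, m a * Real.logb 2 (m a) + δ := by
  have hne : Nonempty A := by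
    by_contra h
    rw [not_nonempty_iff] at h
    simp at hm1
  have hcard : (0 : ℝ) < Fintype.card A := by exact_mod_cast Fintype.card_pos
  -- Shrinking `m` by this factor costs exactly `δ` bits. The freed mass, spread uniformly, gives
  -- null symbols finite codewords too, as the code must be defined on them.
  set θ : ℝ := 2 ^ (-δ) with hθ
  have hθ0 : 0 < θ := by positivity
  have hθ1 : θ < 1 := Real.rpow_lt_one_of_one_lt_of_neg one_lt_two (neg_neg_of_pos hδ)
  have hu : 0 < (1 - θ) / Fintype.card A := div_pos (sub_pos.2 hθ1) hcard
  refine ⟨fun a => θ * m a + (1 - θ) / Fintype.card A,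
    fun a => add_pos_of_nonneg_of_pos (mul_nonneg hθ0.le (hm a)) hu, ?_, ?_⟩
  · rw [Finset.sum_add_distrib, ← Finset.mul_sum, hm1, Finset.sum_const, Finset.card_univ,
      nsmul_eq_mul, mul_div_cancel₀ _ hcard.ne']
    linarith
  · have hδsum : δ = ∑ a, δ * m a := by rw [← Finset.mul_sum, hm1, mul_one]
    rw [hδsum, ← Finset.sum_neg_distrib, ← Finset.sum_add_distrib]
    refine Finset.sum_le_sum fun a _ => ?_
    rcases (hm a).eq_or_lt with h | h
    · simp [← h]
    · have h1 : Real.logb 2 (θ * m a) ≤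
          Real.logb 2 (θ * m a + (1 - θ) / Fintype.card A) :=
        Real.logb_le_logb_of_le one_lt_two (mul_pos hθ0 h) (by linarith)
      have h2 : Real.logb 2 (θ * m a) = -δ + Real.logb 2 (m a) := by
        rw [Real.logb_mul hθ0.ne' h.ne', hθ, Real.logb_rpow two_pos (by norm_num)]
      rw [h2] at h1
      nlinarith

end Shannon

/-! ### Face codes obtained by dyadic quantization -/

section UpperBound

/-- The face of a point together with the index of the dyadic cube of its free coordinates. -/
noncomputable def quantize (b : Elim K) (N : ℕ) (y : Simplex K) :
    Σ I : Face K, (Free b I → Fin (2 ^ N)) :=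
  ⟨faceOf y, fun i => ⟨dyadicIndex N (freeCoord b (faceOf y) y) i,
    dyadicIndex_lt (freeCoord_mem_unitCube (mem_relInt_faceOf y)) i⟩⟩

theorem mem_cell_quantize (N : ℕ) (y : Simplex K) :
    y ∈ cell b N (quantize b N y).1 (quantize b N y).2 :=
  ⟨mem_relInt_faceOf y,
    (mem_dyadicCube_iff (x := freeCoord b (faceOf y) y) fun i => y.2.1 i).2 rfl⟩

theorem quantize_preimage (N : ℕ) (a : Σ I : Face K, (Free b I → Fin (2 ^ N))) :
    quantize b N ⁻¹' {a} = cell b N a.1 a.2 := by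
  obtain ⟨I, k⟩ := a
  ext y
  constructor
  · intro h
    have h' : quantize b N y = ⟨I, k⟩ := h
    have := mem_cell_quantize (b := b) N y
    rwa [h'] at this
  · rintro ⟨h1, h2⟩
    obtain rfl : faceOf y = I := faceOf_eq_iff.2 h1
    have h3 := (mem_dyadicCube_iff (x := freeCoord b (faceOf y) y) fun i => y.2.1 i).1 h2
    have h4 : (quantize b N y).2 = k := funext fun i => Fin.ext (congrFun h3 i)
    change quantize b N y = _
    rw [← h4]
    rfl

theorem measurableSet_quantize_preimage (N : ℕ) (a : Σ I : Face K, (Free b I → Fin (2 ^ N))) :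
    MeasurableSet (quantize b N ⁻¹' {a}) := by
  rw [quantize_preimage]; exact measurableSet_cell N a.1 a.2

theorem isFaceCode_of_injective {N n : ℕ}
    {code : (Fin n → Σ I : Face K, (Free b I → Fin (2 ^ N))) → List Bool}
    (hinj : Function.Injective code) (hpre : PrefixFree (Set.range code))
    (hnil : [] ∉ Set.range code) :
    IsFaceCode b N n (fun y => code fun t => quantize b N (y t)) ∧
      PrefixFree (Set.range fun y : Fin n → Simplex K => code fun t => quantize b N (y t)) := by
  have hsub : Set.range (fun y : Fin n → Simplex K => code fun t => quantize b N (y t)) ⊆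
      Set.range code := by
    rintro _ ⟨y, rfl⟩
    exact ⟨_, rfl⟩
  have hpre' : PrefixFree (Set.range fun y : Fin n → Simplex K =>
      code fun t => quantize b N (y t)) := fun w hw w' hw' => hpre w (hsub hw) w' (hsub hw')
  have heq : ∀ y y' : Fin n → Simplex K, (code fun t => quantize b N (y t)) =
      (code fun t => quantize b N (y' t)) → ∀ t, quantize b N (y t) = quantize b N (y' t) :=
    fun y y' h t => congrFun (hinj h) t
  refine ⟨⟨fun w => ?_, hpre'.uniquelyDecodable fun h => hnil (hsub h), ?_, ?_⟩, hpre'⟩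
  · have : (fun y : Fin n → Simplex K => code fun t => quantize b N (y t)) ⁻¹' {w} =
        ⋃ a : code ⁻¹' {w}, ⋂ t, (fun y => y t) ⁻¹' (quantize b N ⁻¹' {a.1 t}) := by
      ext y
      simp only [Set.mem_preimage, Set.mem_singleton_iff, Set.mem_iUnion, Set.mem_iInter]
      constructor
      · intro h
        exact ⟨⟨_, h⟩, fun t => rfl⟩
      · rintro ⟨⟨a, ha⟩, h⟩
        rw [← show code a = w from ha]
        exact congrArg code (funext h)
    rw [this]
    exact MeasurableSet.iUnion fun a => MeasurableSet.iInter fun t =>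
      measurable_pi_apply t (measurableSet_quantize_preimage N _)
  · intro y y' h t
    exact congrArg (fun a : Σ I : Face K, (Free b I → Fin (2 ^ N)) => a.1.1) (heq y y' h t)
  · intro y y' h t I hI i
    have h1 := mem_cell_quantize (b := b) N (y t)
    have h2 := mem_cell_quantize (b := b) N (y' t)
    rw [← heq y y' h t] at h2
    obtain rfl : faceOf (y t) = I := faceOf_eq_iff.2 hI
    exact abs_sub_le_of_mem_dyadicCube h1.2 h2.2 i

/-- Only the single-point quantized entropy restricts `N`; the block code adds at most one bit in
total, whence a threshold valid for all `n`. -/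
theorem exists_faceCode [IsProbabilityMeasure μ] (hp : Measurable p) (h0 : ∀ y, 0 ≤ p y)
    (hμ : μ = (directSumMeasure b).withDensity fun y => ENNReal.ofReal (p y)) {B : ℝ}
    (hB : directSumEntropy b μ p < B) :
    ∃ N₀ : ℕ, ∀ N ≥ N₀, ∀ n : ℕ, ∃ c : (Fin n → Simplex K) → List Bool,
      IsFaceCode b N n c ∧ PrefixFree (Set.range c) ∧
        (expectedLength μ c : EReal) ≤ ((n * (B + N * meanFaceDim μ) + 1 : ℝ) : EReal) := by
  -- `B'` bounds the quantized entropy less `N d`, and the slack `B - B'` pays for smoothing the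
  -- distribution.
  obtain ⟨B', hB1, hB2⟩ := EReal.lt_iff_exists_real_btwn.1 hB
  have hBB : B' < B := EReal.coe_lt_coe_iff.1 hB2
  obtain ⟨N₀, hN₀⟩ := Filter.eventually_atTop.1 (eventually_quantized_entropy_lt hp h0 hμ hB1)
  refine ⟨N₀, fun N hN n => ?_⟩
  have hent := hN₀ N hN
  have hmeas := measurableSet_quantize_preimage (b := b) N
  have hm1 : ∑ a, μ.real (quantize b N ⁻¹' {a}) = 1 := by
    have := integral_comp_of_finite μ hmeas fun _ => (1 : ℝ)
    simpa using this.symm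
  obtain ⟨Q, hQ, hQ1, hcross⟩ := exists_distribution_cross_entropy_le
    (fun a => measureReal_nonneg) hm1 (sub_pos.2 hBB)
  have hsum : ∑ a, μ.real (quantize b N ⁻¹' {a}) * Real.logb 2 (μ.real (quantize b N ⁻¹' {a})) =
      ∑ I : Face K, ∑ k, μ.real (cell b N I k) * Real.logb 2 (μ.real (cell b N I k)) := by
    simp_rw [quantize_preimage]
    exact Fintype.sum_sigma _
  rw [hsum] at hcross
  obtain ⟨code, hinj, hpre, hnil, hlen⟩ := exists_shannon_code μ hmeas hQ hQ1 n
  obtain ⟨hc1, hc2⟩ := isFaceCode_of_injective hinj hpre hnil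
  refine ⟨_, hc1, hc2, ?_⟩
  set S := ∑ a, -Real.logb 2 (Q a) * μ.real (quantize b N ⁻¹' {a}) with hS
  have hS0 : 0 ≤ S := Finset.sum_nonneg fun a _ => mul_nonneg
    (neg_nonneg.2 (Real.logb_nonpos one_lt_two (hQ a).le
      ((Finset.single_le_sum (fun a _ => (hQ a).le) (Finset.mem_univ a)).trans hQ1)))
    measureReal_nonneg
  have hr : 0 ≤ n * S + 1 := by positivity
  have hle : (n : ℝ) * S + 1 ≤ n * (B + N * meanFaceDim μ) + 1 := by
    have : S ≤ B + N * meanFaceDim μ := by linarith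
    have := mul_le_mul_of_nonneg_left this (Nat.cast_nonneg (α := ℝ) n)
    linarith
  calc (expectedLength μ _ : EReal) ≤ ((ENNReal.ofReal (n * S + 1) : ℝ≥0∞) : EReal) :=
        EReal.coe_ennreal_le_coe_ennreal_iff.2 hlen
    _ = ((n * S + 1 : ℝ) : EReal) := by rw [EReal.coe_ennreal_ofReal, max_eq_left hr]
    _ ≤ _ := EReal.coe_le_coe_iff.2 hle

end UpperBound

end MixedRV

theorem mainTheorem3 {K : ℕ} (b : MixedRV.Elim K) {Ω : Type*} [MeasurableSpace Ω]
    (P : Measure Ω) [IsProbabilityMeasure P] (Y : Ω → MixedRV.Simplex K)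
    (p : MixedRV.Simplex K → ℝ) (hY : MixedRV.IsMixed b P Y p) :
    (∀ N n : ℕ, 0 < n → ∀ c : (Fin n → MixedRV.Simplex K) → List Bool,
      MixedRV.IsFaceCode b N n c →
        (n : EReal) * MixedRV.codeLength b (Measure.map Y P) p N ≤
          (MixedRV.expectedLength (Measure.map Y P) c : EReal)) ∧
    (∀ B : ℝ, MixedRV.directSumEntropy b (Measure.map Y P) p < (B : EReal) →
      ∃ N₀ : ℕ, ∀ N ≥ N₀, ∀ n : ℕ, 0 < n → ∃ c : (Fin n → MixedRV.Simplex K) → List Bool,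
        MixedRV.IsFaceCode b N n c ∧ MixedRV.PrefixFree (Set.range c) ∧
          (MixedRV.expectedLength (Measure.map Y P) c : EReal) ≤
            ((n * (B + N * MixedRV.meanFaceDim (Measure.map Y P)) + 1 : ℝ) : EReal)) := by
  have : IsProbabilityMeasure (Measure.map Y P) :=
    Measure.isProbabilityMeasure_map hY.measurable_Y.aemeasurable
  refine ⟨fun N n hn c hc =>
    MixedRV.mul_codeLength_le_expectedLength hY.measurable_p hY.nonneg hY.law hn hc,
    fun B hB => ?_⟩
  obtain ⟨N₀, h⟩ := MixedRV.exists_faceCode hY.measurable_p hY.nonneg hY.law hB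
  exact ⟨N₀, fun N hN n _ => h N hN n⟩
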